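/- Let $N\ge 4$ be an integer, let $\frac{N^2-4N+2}{N(N-2)}<\beta<1$, and put $\gamma=\frac{N}{(N-2)(1-\beta)}$ and $$\alpha_\beta=N\big[(N-2)N V_N\big]^{\frac{2}{(N-2)(1-\beta)}}(1-\beta)^{\frac1{1-\beta}},$$ where $V_N$ is the volume of the unit ball of $\mathbb{R}^N$. Let $\chi:[1,\infty)\to[1,\infty)$ be continuous with $\chi(1)=1$, and suppose that there is $M>0$ such that for all $r\ge1$ $$\frac{1}{r^{N^2/2}}\Big(\int_1^r t^{N-1}\chi(t)\,dt\Big)\Big(\int_1^r\frac{t^{N-1}}{\chi(t)}\,dt\Big)^{\frac N2-1}\le M,\qquad \frac{1}{r^{N^2/2}}\int_1^r t^{N-1}\chi(t)\,dt\le M,\qquad \frac{\max_{r\le t\le 4r}\chi(t)}{\min_{r\le t\le4r}\chi(t)}\le M .$$ Let $w_\beta(x)=\big(\log\frac{e}{|x|}\big)^{\beta(\frac N2-1)}$ for $|x|<1$ and $w_\beta(x)=\chi(|x|)$ for $|x|\ge1$. Let $E$ be the space of all radial $u\in L^{N/2}(\mathbb{R}^N)$ whose weak gradient and weak Laplacian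 satisfy $\int_{\mathbb{R}^N}\big(|\Delta u|^{N/2}w_\beta+|\nabla u|^{N/2}\big)dx<\infty$, with the norm given by $$\|u\|^{N/2}=\int_{\mathbb{R}^N}|\Delta u|^{N/2}w_\beta\,dx+\int_{\mathbb{R}^N}|\nabla u|^{N/2}\,dx+\int_{\mathbb{R}^N}|u|^{N/2}\,dx .$$ Let $(u_k)$ be a sequence in $E$ and $u\in E$, $u\not\equiv0$, such that $\|u_k\|=1$ for all $k$, $u_k\rightharpoonup u$ weakly in $E$, and $u_k\to u$, $\nabla u_k\to\nabla u$, $\Delta u_k\to\Delta u$ almost everywhere in $\mathbb{R}^N$. Then $$\sup_k\int_{\mathbb{R}^N}\big(e^{p\,\alpha_\beta|u_k|^\gamma}-1\big)\,dx<+\infty\qquad\text{for every real } p \text{ with } 1<p<U(u),$$ where $U(u)=(1-\|u\|^{N/2})^{-2\gamma/N}$ if $\|u\|<1$ and $U(u)=+\infty$ if $\|u\|=1$. In particular the supremum of the integrals over the unit ball is finite. -/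

import Mathlib

open MeasureTheory Filter Topology
open scoped ENNReal ContDiff

noncomputable section

namespace LogAdams

/-- The Euclidean space `ℝ^N`. -/
abbrev Sp (N : ℕ) : Type := EuclideanSpace ℝ (Fin N)

/-- The admissible profiles `χ : [1,∞) → [1,∞)` of the weight outside the unit ball (the values of
`toFun` on `(-∞, 1)` play no role). -/
structure WeightProfile (N : ℕ) where
  toFun : ℝ → ℝ
  continuousOn : ContinuousOn toFun (Set.Ici 1)
  map_one : toFun 1 = 1
  one_le : ∀ t : ℝ, 1 ≤ t → 1 ≤ toFun t
  growth : ∃ M : ℝ, 0 < M ∧ ∀ r : ℝ, 1 ≤ r →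
    1 / r ^ ((N : ℝ) ^ 2 / 2) * (∫ t in (1 : ℝ)..r, t ^ (N - 1) * toFun t) *
        (∫ t in (1 : ℝ)..r, t ^ (N - 1) / toFun t) ^ ((N : ℝ) / 2 - 1) ≤ M ∧
    1 / r ^ ((N : ℝ) ^ 2 / 2) * (∫ t in (1 : ℝ)..r, t ^ (N - 1) * toFun t) ≤ M ∧
    sSup (toFun '' Set.Icc r (4 * r)) / sInf (toFun '' Set.Icc r (4 * r)) ≤ M

/-- The weight `w_β`. -/
def weight {N : ℕ} (β : ℝ) (χ : WeightProfile N) (x : Sp N) : ℝ :=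
  if ‖x‖ < 1 then Real.log (Real.exp 1 / ‖x‖) ^ (β * ((N : ℝ) / 2 - 1)) else χ.toFun ‖x‖

/-- The measure `w_β(x) dx`. -/
def weightMeasure {N : ℕ} (β : ℝ) (χ : WeightProfile N) : Measure (Sp N) :=
  volume.withDensity fun x => ENNReal.ofReal (weight β χ x)

theorem measurable_weight {N : ℕ} (β : ℝ) (χ : WeightProfile N) : Measurable (weight β χ) := by
  have h1 : Measurable fun r : ℝ =>
      if r < 1 then Real.log (Real.exp 1 / r) ^ (β * ((N : ℝ) / 2 - 1)) else χ.toFun r := by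
    classical
    have hm : Measurable fun r : ℝ => χ.toFun (max 1 r) := by
      have : Continuous fun r : ℝ => χ.toFun (max 1 r) :=
        χ.continuousOn.comp_continuous (by fun_prop) fun r => Set.mem_Ici.2 (le_max_left _ _)
      exact this.measurable
    have h2 : Measurable fun r : ℝ =>
        if r < 1 then Real.log (Real.exp 1 / r) ^ (β * ((N : ℝ) / 2 - 1))
        else χ.toFun (max 1 r) := by
      refine Measurable.ite measurableSet_Iio ?_ hm
      fun_prop
    convert h2 using 2 with r
    split_ifs with h
    · rfl
    · rw [max_eq_right (not_lt.1 h)]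
  exact h1.comp measurable_norm

theorem weight_pos {N : ℕ} (β : ℝ) (χ : WeightProfile N) {x : Sp N} (hx : x ≠ 0) :
    0 < weight β χ x := by
  unfold weight
  split_ifs with h
  · apply Real.rpow_pos_of_pos
    have hx' : 0 < ‖x‖ := norm_pos_iff.2 hx
    apply Real.log_pos
    rw [lt_div_iff₀ hx']
    have := Real.add_one_lt_exp (one_ne_zero : (1 : ℝ) ≠ 0)
    linarith
  · exact lt_of_lt_of_le one_pos (χ.one_le _ (not_lt.1 h))

/-- The exponent `N / 2`. -/
def halfDim (N : ℕ) : ℝ≥0∞ := (N : ℝ≥0∞) / 2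

theorem halfDim_toReal (N : ℕ) : (halfDim N).toReal = (N : ℝ) / 2 := by
  simp [halfDim]

theorem halfDim_ne_top (N : ℕ) : halfDim N ≠ ⊤ := by
  simp [halfDim, ENNReal.div_eq_top]

instance instOneLeHalfDim (N : ℕ) [h : Fact (4 ≤ N)] : Fact (1 ≤ halfDim N) := by
  refine ⟨?_⟩
  rw [← ENNReal.toReal_le_toReal ENNReal.one_ne_top (halfDim_ne_top N), halfDim_toReal]
  have : (4 : ℝ) ≤ N := by exact_mod_cast h.out
  simp only [ENNReal.toReal_one]
  linarith

theorem volume_absolutelyContinuous {N : ℕ} [h : Fact (4 ≤ N)] (β : ℝ) (χ : WeightProfile N) :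
    (volume : Measure (Sp N)) ≪ weightMeasure β χ := by
  have : Nontrivial (Sp N) := by
    have : Nonempty (Fin N) := ⟨⟨0, by have := h.out; omega⟩⟩
    infer_instance
  refine withDensity_absolutelyContinuous' ?_ ?_
  · exact (measurable_weight β χ).ennreal_ofReal.aemeasurable
  · filter_upwards [Measure.ae_ne volume (0 : Sp N)] with x hx
    simpa using weight_pos β χ hx

/-- Test functions: the elements of `C_0^∞(ℝ^N)`. -/
def IsTest {N : ℕ} (φ : Sp N → ℝ) : Prop := ContDiff ℝ ∞ φ ∧ HasCompactSupport φ

/-- `g` is the weak (distributional) gradient of `u` on `ℝ^N`. -/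
def IsWeakGradient {N : ℕ} (u : Sp N → ℝ) (g : Sp N → Sp N) : Prop :=
  LocallyIntegrable u ∧ LocallyIntegrable g ∧
    ∀ φ : Sp N → ℝ, IsTest φ → ∀ v : Sp N,
      ∫ x, fderiv ℝ φ x v * u x = - ∫ x, φ x * inner ℝ v (g x)

/-- `h` is the weak (distributional) Laplacian of `u` on `ℝ^N`. -/
def IsWeakLaplacian {N : ℕ} (u h : Sp N → ℝ) : Prop :=
  LocallyIntegrable u ∧ LocallyIntegrable h ∧
    ∀ φ : Sp N → ℝ, IsTest φ → ∫ x, Laplacian.laplacian φ x * u x = ∫ x, φ x * h x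

/-- `u` agrees almost everywhere with a (measurable) function of `|x|`. -/
def IsRadial {N : ℕ} (u : Sp N → ℝ) : Prop :=
  ∃ f : ℝ → ℝ, Measurable f ∧ ∀ᵐ x : Sp N, u x = f ‖x‖

theorem IsTest.continuous_laplacian {N : ℕ} {φ : Sp N → ℝ} (hφ : IsTest φ) :
    Continuous (Laplacian.laplacian φ) := by
  rw [InnerProductSpace.laplacian_eq_iteratedFDeriv_stdOrthonormalBasis]
  refine continuous_finsetSum _ fun i _ => ?_
  have := hφ.1.continuous_iteratedFDeriv (m := 2) (WithTop.coe_le_coe.2 (le_top : (2 : ℕ∞) ≤ ⊤))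
  exact (ContinuousMultilinearMap.apply ℝ (fun _ : Fin 2 => Sp N) ℝ _).continuous.comp this

theorem IsTest.hasCompactSupport_laplacian {N : ℕ} {φ : Sp N → ℝ} (hφ : IsTest φ) :
    HasCompactSupport (Laplacian.laplacian φ) := by
  rw [InnerProductSpace.laplacian_eq_iteratedFDeriv_stdOrthonormalBasis]
  refine (hφ.2.iteratedFDeriv (𝕜 := ℝ) 2).mono fun x hx => ?_
  simp only [Function.mem_support] at hx ⊢
  intro h0
  exact hx (by simp [h0])

theorem IsWeakGradient.congr {N : ℕ} {u u' : Sp N → ℝ} {g g' : Sp N → Sp N}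
    (h : IsWeakGradient u g) (hu : u =ᵐ[volume] u') (hg : g =ᵐ[volume] g') :
    IsWeakGradient u' g' := by
  refine ⟨h.1.congr hu, h.2.1.congr hg, fun φ hφ v => ?_⟩
  have h1 : ∫ x, fderiv ℝ φ x v * u' x = ∫ x, fderiv ℝ φ x v * u x :=
    integral_congr_ae (by filter_upwards [hu] with x hx; rw [hx])
  have h2 : ∫ x, φ x * inner ℝ v (g' x) = ∫ x, φ x * inner ℝ v (g x) :=
    integral_congr_ae (by filter_upwards [hg] with x hx; rw [hx])
  rw [h1, h2, h.2.2 φ hφ v]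

theorem IsWeakGradient.add {N : ℕ} {u u' : Sp N → ℝ} {g g' : Sp N → Sp N}
    (h : IsWeakGradient u g) (h' : IsWeakGradient u' g') :
    IsWeakGradient (u + u') (g + g') := by
  refine ⟨h.1.add h'.1, h.2.1.add h'.2.1, fun φ hφ v => ?_⟩
  have hc : Continuous fun x => fderiv ℝ φ x v :=
    (hφ.1.continuous_fderiv (by simp)).clm_apply continuous_const
  have hs : HasCompactSupport fun x => fderiv ℝ φ x v := hφ.2.fderiv_apply (𝕜 := ℝ) v
  have i1 : ∀ {w : Sp N → ℝ}, LocallyIntegrable w → Integrable fun x => fderiv ℝ φ x v * w x :=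
    fun hw => hw.integrable_smul_left_of_hasCompactSupport hc hs
  have i2 : ∀ {w : Sp N → Sp N}, LocallyIntegrable w →
      Integrable fun x => φ x * inner ℝ v (w x) := fun {w} hw => by
    have := (hw.integrable_smul_left_of_hasCompactSupport hφ.1.continuous hφ.2).const_inner
      (𝕜 := ℝ) v
    simpa [inner_smul_right] using this
  simp only [Pi.add_apply, mul_add, inner_add_right]
  rw [integral_add (i1 h.1) (i1 h'.1), integral_add (i2 h.2.1) (i2 h'.2.1), h.2.2 φ hφ v,
    h'.2.2 φ hφ v]
  ring

theorem IsWeakGradient.smul {N : ℕ} {u : Sp N → ℝ} {g : Sp N → Sp N} (c : ℝ)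
    (h : IsWeakGradient u g) : IsWeakGradient (c • u) (c • g) := by
  refine ⟨h.1.smul c, h.2.1.smul c, fun φ hφ v => ?_⟩
  simp only [Pi.smul_apply, smul_eq_mul, inner_smul_right, mul_left_comm _ c]
  rw [integral_const_mul, integral_const_mul, h.2.2 φ hφ v]
  ring

theorem IsWeakLaplacian.congr {N : ℕ} {u u' h h' : Sp N → ℝ}
    (H : IsWeakLaplacian u h) (hu : u =ᵐ[volume] u') (hh : h =ᵐ[volume] h') :
    IsWeakLaplacian u' h' := by
  refine ⟨H.1.congr hu, H.2.1.congr hh, fun φ hφ => ?_⟩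
  have h1 : ∫ x, Laplacian.laplacian φ x * u' x = ∫ x, Laplacian.laplacian φ x * u x :=
    integral_congr_ae (by filter_upwards [hu] with x hx; rw [hx])
  have h2 : ∫ x, φ x * h' x = ∫ x, φ x * h x :=
    integral_congr_ae (by filter_upwards [hh] with x hx; rw [hx])
  rw [h1, h2, H.2.2 φ hφ]

theorem IsWeakLaplacian.add {N : ℕ} {u u' h h' : Sp N → ℝ}
    (H : IsWeakLaplacian u h) (H' : IsWeakLaplacian u' h') :
    IsWeakLaplacian (u + u') (h + h') := by
  refine ⟨H.1.add H'.1, H.2.1.add H'.2.1, fun φ hφ => ?_⟩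
  have i1 : ∀ {w : Sp N → ℝ}, LocallyIntegrable w →
      Integrable fun x => Laplacian.laplacian φ x * w x := fun hw =>
    hw.integrable_smul_left_of_hasCompactSupport hφ.continuous_laplacian
      hφ.hasCompactSupport_laplacian
  have i2 : ∀ {w : Sp N → ℝ}, LocallyIntegrable w → Integrable fun x => φ x * w x := fun hw =>
    hw.integrable_smul_left_of_hasCompactSupport hφ.1.continuous hφ.2
  simp only [Pi.add_apply, mul_add]
  rw [integral_add (i1 H.1) (i1 H'.1), integral_add (i2 H.2.1) (i2 H'.2.1), H.2.2 φ hφ,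
    H'.2.2 φ hφ]

theorem IsWeakLaplacian.smul {N : ℕ} {u h : Sp N → ℝ} (c : ℝ)
    (H : IsWeakLaplacian u h) : IsWeakLaplacian (c • u) (c • h) := by
  refine ⟨H.1.smul c, H.2.1.smul c, fun φ hφ => ?_⟩
  simp only [Pi.smul_apply, smul_eq_mul, mul_left_comm _ c]
  rw [integral_const_mul, integral_const_mul, H.2.2 φ hφ]

/-- `L^{N/2}(dx) × L^{N/2}(dx; ℝ^N) × L^{N/2}(w_β dx)` with the `ℓ^{N/2}` product norm. -/
abbrev Triples {N : ℕ} (β : ℝ) (χ : WeightProfile N) : Type :=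
  WithLp (halfDim N) (Lp ℝ (halfDim N) (volume : Measure (Sp N)) ×
    WithLp (halfDim N) (Lp (Sp N) (halfDim N) (volume : Measure (Sp N)) ×
      Lp ℝ (halfDim N) (weightMeasure β χ)))

/-- The space `E` of the radial `u ∈ L^{N/2}(ℝ^N)` whose weak gradient lies in `L^{N/2}(ℝ^N)` and
whose weak Laplacian lies in `L^{N/2}(ℝ^N, w_β dx)`. An element is stored as the triple
`(u, ∇u, Δu)`, which is determined by `u`; the norm is the one inherited from `Triples`, i.e.
`‖u‖^{N/2} = ∫ |Δu|^{N/2} w_β + ∫ |∇u|^{N/2} + ∫ |u|^{N/2}` (see `norm_rpow`). -/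
def E {N : ℕ} [Fact (4 ≤ N)] (β : ℝ) (χ : WeightProfile N) : Submodule ℝ (Triples β χ) where
  carrier := {T | IsRadial (T.fst : Sp N → ℝ) ∧
    IsWeakGradient (T.fst : Sp N → ℝ) (T.snd.fst : Sp N → Sp N) ∧
    IsWeakLaplacian (T.fst : Sp N → ℝ) (T.snd.snd : Sp N → ℝ)}
  zero_mem' := by
    have h1 : (((0 : Triples β χ).fst : Sp N → ℝ)) =ᵐ[volume] 0 := Lp.coeFn_zero _ _ _
    have h2 : (((0 : Triples β χ).snd.fst : Sp N → Sp N)) =ᵐ[volume] 0 := Lp.coeFn_zero _ _ _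
    have h3 : (((0 : Triples β χ).snd.snd : Sp N → ℝ)) =ᵐ[volume] 0 :=
      (volume_absolutelyContinuous β χ).ae_eq (Lp.coeFn_zero _ _ _)
    have g0 : IsWeakGradient (0 : Sp N → ℝ) (0 : Sp N → Sp N) :=
      ⟨locallyIntegrable_zero, locallyIntegrable_zero, fun φ _ v => by simp⟩
    have l0 : IsWeakLaplacian (0 : Sp N → ℝ) (0 : Sp N → ℝ) :=
      ⟨locallyIntegrable_zero, locallyIntegrable_zero, fun φ _ => by simp⟩
    exact ⟨⟨0, measurable_zero, h1⟩, g0.congr h1.symm h2.symm, l0.congr h1.symm h3.symm⟩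
  add_mem' := by
    rintro T S ⟨⟨f, hf, hTf⟩, hTg, hTl⟩ ⟨⟨f', hf', hSf⟩, hSg, hSl⟩
    have h1 : (((T + S).fst : Sp N → ℝ)) =ᵐ[volume] (T.fst : Sp N → ℝ) + S.fst :=
      Lp.coeFn_add _ _
    have h2 : (((T + S).snd.fst : Sp N → Sp N)) =ᵐ[volume] (T.snd.fst : Sp N → Sp N) + S.snd.fst :=
      Lp.coeFn_add _ _
    have h3 : (((T + S).snd.snd : Sp N → ℝ)) =ᵐ[volume] (T.snd.snd : Sp N → ℝ) + S.snd.snd :=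
      (volume_absolutelyContinuous β χ).ae_eq (Lp.coeFn_add _ _)
    refine ⟨⟨f + f', hf.add hf', ?_⟩, (hTg.add hSg).congr h1.symm h2.symm,
      (hTl.add hSl).congr h1.symm h3.symm⟩
    filter_upwards [h1, hTf, hSf] with x hx ha hb
    rw [hx, Pi.add_apply, ha, hb, Pi.add_apply]
  smul_mem' := by
    rintro c T ⟨⟨f, hf, hTf⟩, hTg, hTl⟩
    have h1 : (((c • T).fst : Sp N → ℝ)) =ᵐ[volume] c • (T.fst : Sp N → ℝ) :=
      Lp.coeFn_smul _ _
    have h2 : (((c • T).snd.fst : Sp N → Sp N)) =ᵐ[volume] c • (T.snd.fst : Sp N → Sp N) :=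
      Lp.coeFn_smul _ _
    have h3 : (((c • T).snd.snd : Sp N → ℝ)) =ᵐ[volume] c • (T.snd.snd : Sp N → ℝ) :=
      (volume_absolutelyContinuous β χ).ae_eq (Lp.coeFn_smul _ _)
    refine ⟨⟨c • f, hf.const_smul c, ?_⟩, (hTg.smul c).congr h1.symm h2.symm,
      (hTl.smul c).congr h1.symm h3.symm⟩
    filter_upwards [h1, hTf] with x hx ha
    rw [hx, Pi.smul_apply, ha, Pi.smul_apply]

section

variable {N : ℕ} [Fact (4 ≤ N)] {β : ℝ} {χ : WeightProfile N}

/-- The function `u` underlying an element of `E`. -/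
def fn (u : E β χ) : Sp N → ℝ := (u : Triples β χ).fst

/-- Its gradient `∇u`. -/
def grad (u : E β χ) : Sp N → Sp N := (u : Triples β χ).snd.fst

/-- Its Laplacian `Δu`. -/
def lap (u : E β χ) : Sp N → ℝ := (u : Triples β χ).snd.snd

theorem Lp_norm_rpow {F : Type*} [NormedAddCommGroup F] {μ : Measure (Sp N)}
    (f : Lp F (halfDim N) μ) : ‖f‖ ^ ((N : ℝ) / 2) = ∫ x, ‖f x‖ ^ ((N : ℝ) / 2) ∂μ := by
  have hN : (4 : ℝ) ≤ N := by exact_mod_cast (Fact.out : 4 ≤ N)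
  have h1 : halfDim N ≠ 0 := (lt_of_lt_of_le one_pos (Fact.out : 1 ≤ halfDim N)).ne'
  have h0 : 0 ≤ ∫ x, ‖f x‖ ^ ((N : ℝ) / 2) ∂μ := integral_nonneg fun x => by positivity
  rw [Lp.norm_def, (Lp.memLp f).eLpNorm_eq_integral_rpow_norm h1 (halfDim_ne_top N),
    halfDim_toReal, ENNReal.toReal_ofReal (Real.rpow_nonneg h0 _), ← Real.rpow_mul h0,
    inv_mul_cancel₀ (by positivity), Real.rpow_one]

theorem prod_norm_rpow {A B : Type*} [NormedAddCommGroup A] [NormedAddCommGroup B]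
    (f : WithLp (halfDim N) (A × B)) :
    ‖f‖ ^ ((N : ℝ) / 2) = ‖f.fst‖ ^ ((N : ℝ) / 2) + ‖f.snd‖ ^ ((N : ℝ) / 2) := by
  have hN : (4 : ℝ) ≤ N := by exact_mod_cast (Fact.out : 4 ≤ N)
  have h0 : 0 ≤ ‖f.fst‖ ^ ((N : ℝ) / 2) + ‖f.snd‖ ^ ((N : ℝ) / 2) := by positivity
  rw [WithLp.prod_norm_eq_add (by rw [halfDim_toReal]; positivity), halfDim_toReal,
    ← Real.rpow_mul h0, one_div, inv_mul_cancel₀ (by positivity), Real.rpow_one]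

theorem norm_rpow (u : E β χ) :
    ‖u‖ ^ ((N : ℝ) / 2) = (∫ x, |lap u x| ^ ((N : ℝ) / 2) * weight β χ x)
      + (∫ x, ‖grad u x‖ ^ ((N : ℝ) / 2)) + ∫ x, |fn u x| ^ ((N : ℝ) / 2) := by
  have hN : 0 < N := lt_of_lt_of_le (by norm_num) (Fact.out : 4 ≤ N)
  have : Nonempty (Fin N) := ⟨⟨0, hN⟩⟩
  have hw : ∫ x, ‖lap u x‖ ^ ((N : ℝ) / 2) ∂(weightMeasure β χ)
      = ∫ x, |lap u x| ^ ((N : ℝ) / 2) * weight β χ x := by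
    rw [weightMeasure, integral_withDensity_eq_integral_toReal_smul
      (measurable_weight β χ).ennreal_ofReal (by simp)]
    refine integral_congr_ae ?_
    filter_upwards [Measure.ae_ne volume (0 : Sp N)] with x hx
    rw [ENNReal.toReal_ofReal (weight_pos β χ hx).le, smul_eq_mul, mul_comm, Real.norm_eq_abs]
  have hT : ‖u‖ = ‖(u : Triples β χ)‖ := rfl
  rw [hT, prod_norm_rpow, prod_norm_rpow, Lp_norm_rpow, Lp_norm_rpow, Lp_norm_rpow, ← hw]
  simp only [fn, grad, lap, Real.norm_eq_abs]
  ring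

end

/-- The exponent `γ = N / ((N - 2)(1 - β))`. -/
def gammaExp (N : ℕ) (β : ℝ) : ℝ := (N : ℝ) / (((N : ℝ) - 2) * (1 - β))

/-- `V_N`, the volume of the unit ball of `ℝ^N`. -/
def unitBallVolume (N : ℕ) : ℝ := (volume (Metric.ball (0 : Sp N) 1)).toReal

/-- The constant `α_β = N [(N-2) N V_N]^{2/((N-2)(1-β))} (1-β)^{1/(1-β)}`. -/
def alphaBeta (N : ℕ) (β : ℝ) : ℝ :=
  (N : ℝ) * (((N : ℝ) - 2) * N * unitBallVolume N) ^ (2 / (((N : ℝ) - 2) * (1 - β))) *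
    (1 - β) ^ (1 / (1 - β))

/-- The threshold `U(u)`, as a function of `t = ‖u‖`. -/
def threshold (N : ℕ) (β t : ℝ) : EReal :=
  if t < 1 then
    ((1 / (1 - t ^ ((N : ℝ) / 2)) ^ (2 * gammaExp N β / N) : ℝ) : EReal)
  else ⊤

end LogAdams

end

/-! Everything rests on a pointwise bound near the origin (`ae_abs_fn_le_of_norm_sq_lt`): a radial
`v` in `E` satisfies, for a.e. x with |x|² < T ≤ 1, |v(x)| ≤ (c/T)‖v‖ + c_β ‖Δv‖_T L(x)^{1/γ}. Here
‖Δv‖_T is the weighted norm of Δv over the ball |x|² < T alone, L(x) is log(1/|x|) up to an additive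
constant, and α_β c_β^γ ≤ N. Hence if the local norm is at most s, then p α_β|v|^γ is at most about
p s^γ N log(1/|x|), and its exponential is integrable at 0 once p s^γ < 1.

Applied to `u k` itself with ‖u k‖ = 1, this gives a range of p independent of `u₀`. The gain comes
from writing u_k = u₀ + (u_k − u₀). The local norm of the fixed function `u₀` tends to 0 with T, so
it does not affect the leading coefficient. By one half of the Brezis–Lieb lemma, limsup ‖u_k − u₀‖
≤ (1 − ‖u₀‖^{N/2})^{2/N}, and p < U(u₀) says that p times the γ-th power of this number is below 1.
The finitely many k before the limit takes effect are handled by shrinking T once more.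

Away from the origin the u_k are uniformly bounded, and γ ≥ N/2, so the integrand is at most a
constant times |u_k|^{N/2}.

The pointwise bound comes from the weak equation, without regularity theory. In the variable t =
|x|² the radial Laplacian is 4t^{1−N/2}(t^{N/2}φ')', and t^{1−N/2} cancels the polar Jacobian. A
test function with t^{N/2}φ' = θ, where θ is a difference of two distribution functions, makes the
weak equation compare two averages of the profile of v. One average is kept at scale T, the other
shrinks to a point, and Hölder's inequality against the weight produces the logarithm. -/

namespace LogAdams

/-! ### Polar coordinates in the variable t = |x|². -/

section Polar

variable {N : ℕ} [Fact (4 ≤ N)]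

theorem four_le_cast (N : ℕ) [Fact (4 ≤ N)] : (4 : ℝ) ≤ N := by
  exact_mod_cast (Fact.out : 4 ≤ N)

theorem nontrivial_Sp (N : ℕ) [Fact (4 ≤ N)] : Nontrivial (Sp N) := by
  have : Nonempty (Fin N) := ⟨⟨0, by have := (Fact.out : 4 ≤ N); omega⟩⟩
  infer_instance

theorem unitBallVolume_pos (N : ℕ) : 0 < unitBallVolume N :=
  ENNReal.toReal_pos (Metric.measure_ball_pos volume _ one_pos).ne' measure_ball_lt_top.ne

/-- The Jacobian of t = s². Working with t rather than |x| keeps compositions with smooth profiles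
smooth at the origin. -/
theorem jacobian_norm_sq (F : ℝ → ℝ) {s : ℝ} (hs : 0 < s) :
    ((2 : ℝ) * s ^ ((2 : ℝ) - 1)) • ((s ^ (2 : ℝ)) ^ ((N : ℝ) / 2 - 1) * F (s ^ (2 : ℝ)))
      = 2 * (s ^ (N - 1) • F (s ^ 2)) := by
  have hN : 1 ≤ N := le_trans (by norm_num) (Fact.out : 4 ≤ N)
  have h1 : s ^ ((2 : ℝ) - 1) * (s ^ (2 : ℝ)) ^ ((N : ℝ) / 2 - 1) = s ^ (N - 1) := by
    rw [← Real.rpow_mul hs.le, ← Real.rpow_add hs, ← Real.rpow_natCast, Nat.cast_sub hN]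
    congr 1
    push_cast
    ring
  rw [smul_eq_mul, smul_eq_mul, ← h1, Real.rpow_two]
  ring

theorem integrable_comp_norm_sq {F : ℝ → ℝ} :
    Integrable (fun x : Sp N => F (‖x‖ ^ 2)) ↔
      IntegrableOn (fun t => t ^ ((N : ℝ) / 2 - 1) * F t) (Set.Ioi 0) := by
  have := nontrivial_Sp N
  rw [← integrableOn_Ioi_comp_rpow_iff _ (two_ne_zero : (2 : ℝ) ≠ 0),
    integrable_fun_norm_addHaar volume (f := fun s => F (s ^ 2)), finrank_euclideanSpace_fin]
  have h : Set.EqOn (fun x : ℝ => (|(2 : ℝ)| * x ^ ((2 : ℝ) - 1)) •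
      ((x ^ (2 : ℝ)) ^ ((N : ℝ) / 2 - 1) * F (x ^ (2 : ℝ))))
      (fun x => 2 * (x ^ (N - 1) • F (x ^ 2))) (Set.Ioi 0) := fun s hs => by
    simpa only [abs_two] using jacobian_norm_sq F hs
  rw [integrableOn_congr_fun h measurableSet_Ioi]
  exact (integrable_const_mul_iff (isUnit_iff_ne_zero.2 two_ne_zero) _).symm

theorem integral_comp_norm_sq (F : ℝ → ℝ) :
    ∫ x : Sp N, F (‖x‖ ^ 2) = N * unitBallVolume N / 2 *
      ∫ t in Set.Ioi 0, t ^ ((N : ℝ) / 2 - 1) * F t := by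
  have := nontrivial_Sp N
  rw [← integral_comp_rpow_Ioi_of_pos (two_pos : (0 : ℝ) < 2),
    integral_fun_norm_addHaar volume (fun s => F (s ^ 2)), finrank_euclideanSpace_fin,
    setIntegral_congr_fun measurableSet_Ioi fun s hs => jacobian_norm_sq (N := N) F hs,
    integral_const_mul]
  simp only [nsmul_eq_mul, smul_eq_mul, unitBallVolume, Measure.real]
  ring

/-- The indicator of an exceptional null set has integral zero in t, so by the polar formula its
pullback also has integral zero and vanishes almost everywhere. -/
theorem ae_norm_sq {P : ℝ → Prop} (h : ∀ᵐ t, 0 < t → P t) : ∀ᵐ x : Sp N, P (‖x‖ ^ 2) := by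
  have := nontrivial_Sp N
  obtain ⟨Z, hZ, hZm, hZ0⟩ := exists_measurable_superset_of_null (ae_iff.1 h)
  have hz : ∀ᵐ t : ℝ, Z.indicator (fun _ => (1 : ℝ)) t = 0 := by
    filter_upwards [measure_eq_zero_iff_ae_notMem.1 hZ0] with t ht
    simp [ht]
  have hz' : (fun t : ℝ => t ^ ((N : ℝ) / 2 - 1) * Z.indicator (fun _ => (1 : ℝ)) t)
      =ᵐ[volume.restrict (Set.Ioi 0)] 0 := by
    filter_upwards [ae_restrict_of_ae hz] with t ht
    simp [ht]
  have hi : Integrable (fun x : Sp N => Z.indicator (fun _ => (1 : ℝ)) (‖x‖ ^ 2)) :=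
    integrable_comp_norm_sq.2 ((integrable_zero _ _ _).congr hz'.symm)
  have h0 : ∫ x : Sp N, Z.indicator (fun _ => (1 : ℝ)) (‖x‖ ^ 2) = 0 := by
    rw [integral_comp_norm_sq, integral_congr_ae hz']
    simp
  rw [integral_eq_zero_iff_of_nonneg
    (fun x => Set.indicator_nonneg (fun _ _ => zero_le_one) _) hi] at h0
  filter_upwards [h0, Measure.ae_ne volume (0 : Sp N)] with x hx hx0
  by_contra hP
  have hmem : ‖x‖ ^ 2 ∈ Z := hZ (by
    simp only [Set.mem_ofPred_eq, Classical.not_imp]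
    exact ⟨by positivity, hP⟩)
  simp [hmem] at hx

end Polar

/-! ### The Laplacian of a smooth function of |x|². -/

section RadialLaplacian

variable {N : ℕ}

theorem hasFDerivAt_comp_norm_sq {Ψ : ℝ → ℝ} (hΨ : Differentiable ℝ Ψ) (x : Sp N) :
    HasFDerivAt (fun x : Sp N => Ψ (‖x‖ ^ 2)) (deriv Ψ (‖x‖ ^ 2) • (2 • innerSL ℝ x)) x :=
  (hΨ _).hasDerivAt.comp_hasFDerivAt x (hasStrictFDerivAt_norm_sq x).hasFDerivAt

theorem laplacian_comp_norm_sq {Ψ : ℝ → ℝ} (hΨ : ContDiff ℝ ∞ Ψ) (x : Sp N) :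
    Laplacian.laplacian (fun x : Sp N => Ψ (‖x‖ ^ 2)) x
      = 4 * ‖x‖ ^ 2 * deriv (deriv Ψ) (‖x‖ ^ 2) + 2 * N * deriv Ψ (‖x‖ ^ 2) := by
  have hd : Differentiable ℝ Ψ := hΨ.differentiable (by simp)
  have hd' : Differentiable ℝ (deriv Ψ) :=
    (contDiff_infty_iff_deriv.1 hΨ).2.differentiable (by simp)
  have h1 : fderiv ℝ (fun x : Sp N => Ψ (‖x‖ ^ 2))
      = fun x => deriv Ψ (‖x‖ ^ 2) • (2 • innerSL ℝ x) :=
    funext fun x => (hasFDerivAt_comp_norm_sq hd x).fderiv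
  have h2 : ∀ v : Sp N, fderiv ℝ (fderiv ℝ (fun x : Sp N => Ψ (‖x‖ ^ 2))) x v v
      = 4 * deriv (deriv Ψ) (‖x‖ ^ 2) * inner ℝ v x ^ 2 + 2 * deriv Ψ (‖x‖ ^ 2) * ‖v‖ ^ 2 := by
    intro v
    have hL : HasFDerivAt (fun x : Sp N => 2 • innerSL ℝ x) (2 • innerSL ℝ (E := Sp N)) x :=
      (2 • innerSL ℝ (E := Sp N)).hasFDerivAt
    have := (hasFDerivAt_comp_norm_sq hd' x).smul hL
    rw [h1, show fderiv ℝ (fun x : Sp N => deriv Ψ (‖x‖ ^ 2) • 2 • innerSL ℝ x) x = _ from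
      this.fderiv]
    have hv : innerSL ℝ v v = ‖v‖ ^ 2 := real_inner_self_eq_norm_sq v
    simp [real_inner_comm x v]
    linear_combination 2 * deriv Ψ (‖x‖ ^ 2) * hv
  rw [InnerProductSpace.laplacian_eq_iteratedFDeriv_stdOrthonormalBasis]
  simp only [iteratedFDeriv_two_apply, Matrix.cons_val_zero, Matrix.cons_val_one, h2]
  rw [Finset.sum_add_distrib, ← Finset.mul_sum, ← Finset.mul_sum,
    (stdOrthonormalBasis ℝ (Sp N)).sum_sq_inner_right]
  simp
  ring

end RadialLaplacian
-- Radial test functions with prescribed flux θ.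
section RadialTest

variable {N : ℕ} {θ : ℝ → ℝ} {δ T : ℝ}

theorem contDiff_rpow_mul (hδ : 0 < δ) (hθ : ContDiff ℝ ∞ θ) (h0 : ∀ t < δ, θ t = 0) (a : ℝ) :
    ContDiff ℝ ∞ fun t => t ^ a * θ t := by
  rw [contDiff_iff_contDiffAt]
  intro t
  rcases lt_or_ge t δ with ht | ht
  · refine contDiffAt_const (c := (0 : ℝ)) |>.congr_of_eventuallyEq ?_
    filter_upwards [Iio_mem_nhds ht] with s hs
    rw [h0 s hs, mul_zero]
  · exact (Real.contDiffAt_rpow_const_of_ne (hδ.trans_le ht).ne').mul hθ.contDiffAt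

/-- The radial profile, as a function of `t = |x|²`, of the solution of
`Δφ = 4 |x|^{2-N} θ'(|x|²)` vanishing for `|x|² ≥ T`. -/
noncomputable def potential (N : ℕ) (θ : ℝ → ℝ) (T t : ℝ) : ℝ :=
  ∫ s in T..t, s ^ (-((N : ℝ) / 2)) * θ s

theorem deriv_potential (hδ : 0 < δ) (hθ : ContDiff ℝ ∞ θ) (h0 : ∀ t < δ, θ t = 0) :
    deriv (potential N θ T) = fun t => t ^ (-((N : ℝ) / 2)) * θ t := by
  have hc := (contDiff_rpow_mul hδ hθ h0 (-((N : ℝ) / 2))).continuous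
  exact funext fun t => (intervalIntegral.integral_hasDerivAt_right (hc.intervalIntegrable _ _)
    (hc.stronglyMeasurableAtFilter _ _) hc.continuousAt).deriv

theorem contDiff_potential (hδ : 0 < δ) (hθ : ContDiff ℝ ∞ θ) (h0 : ∀ t < δ, θ t = 0) :
    ContDiff ℝ ∞ (potential N θ T) := by
  have hc := (contDiff_rpow_mul hδ hθ h0 (-((N : ℝ) / 2)))
  refine contDiff_infty_iff_deriv.2 ⟨fun t => ?_, by rwa [deriv_potential hδ hθ h0]⟩
  exact (intervalIntegral.integral_hasDerivAt_right (hc.continuous.intervalIntegrable _ _)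
    (hc.continuous.stronglyMeasurableAtFilter _ _) hc.continuous.continuousAt).differentiableAt

theorem potential_eq_zero (h1 : ∀ t, T < t → θ t = 0) {t : ℝ} (ht : T ≤ t) :
    potential N θ T t = 0 := by
  rw [potential]
  refine intervalIntegral.integral_zero_ae (ae_of_all _ fun s hs => ?_)
  rw [Set.uIoc_of_le ht] at hs
  rw [h1 s hs.1, mul_zero]

/-- Since |θ| ≤ 1, the potential is dominated by the tail integral of s^{-N/2}. It is constant below
δ, where θ vanishes, which truncates the bound at δ. -/
theorem abs_potential_le [Fact (4 ≤ N)] (hδ : 0 < δ) (hδT : δ ≤ T) (hθ : ContDiff ℝ ∞ θ)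
    (h0 : ∀ t < δ, θ t = 0) (hb : ∀ t, |θ t| ≤ 1) {t : ℝ} (ht : t ≤ T) :
    |potential N θ T t| ≤ 2 / ((N : ℝ) - 2) * max t δ ^ (1 - (N : ℝ) / 2) := by
  have hN := four_le_cast N
  have hc := (contDiff_rpow_mul hδ hθ h0 (-((N : ℝ) / 2))).continuous
  set m := max t δ with hm
  have hm0 : 0 < m := hδ.trans_le (le_max_right _ _)
  have hmT : m ≤ T := max_le ht hδT
  have e1 : potential N θ T t = potential N θ T m := by
    have : ∫ s in m..t, s ^ (-((N : ℝ) / 2)) * θ s = 0 := by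
      refine intervalIntegral.integral_zero_ae ?_
      -- The endpoint s = δ is not covered by `h0` and is dropped as a null point.
      filter_upwards [Measure.ae_ne volume δ] with s hsδ hs
      rw [Set.uIoc_of_ge (le_max_left _ _)] at hs
      rcases le_total t δ with h | h
      · rw [max_eq_right h] at hs
        rw [h0 s (lt_of_le_of_ne hs.2 hsδ), mul_zero]
      · rw [max_eq_left h] at hs
        exact absurd hs (by simp)
    rw [potential, potential, ← intervalIntegral.integral_add_adjacent_intervals
      (hc.intervalIntegrable T m) (hc.intervalIntegrable m t), this, add_zero]
  have e2 : ∫ s in m..T, s ^ (-((N : ℝ) / 2))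
      = (T ^ (1 - (N : ℝ) / 2) - m ^ (1 - (N : ℝ) / 2)) / (1 - (N : ℝ) / 2) := by
    rw [integral_rpow (Or.inr ⟨by linarith, fun h => ?_⟩)]
    · ring_nf
    · rw [Set.uIcc_of_le hmT] at h
      exact absurd h.1 (by linarith)
  have hi : IntervalIntegrable (fun s : ℝ => s ^ (-((N : ℝ) / 2))) volume m T :=
    intervalIntegral.intervalIntegrable_rpow (Or.inr fun h => by
      rw [Set.uIcc_of_le hmT] at h
      exact absurd h.1 (by linarith))
  rw [e1, potential, intervalIntegral.integral_symm, abs_neg]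
  calc |∫ s in m..T, s ^ (-((N : ℝ) / 2)) * θ s|
      ≤ ∫ s in m..T, |s ^ (-((N : ℝ) / 2)) * θ s| :=
        intervalIntegral.abs_integral_le_integral_abs hmT
    _ ≤ ∫ s in m..T, s ^ (-((N : ℝ) / 2)) := by
        refine intervalIntegral.integral_mono_on hmT (hc.abs.intervalIntegrable _ _) hi
          fun s hs => ?_
        have hs0 : 0 ≤ s ^ (-((N : ℝ) / 2)) := Real.rpow_nonneg (hm0.le.trans hs.1) _
        rw [abs_mul, abs_of_nonneg hs0]
        exact mul_le_of_le_one_right hs0 (hb s)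
    _ ≤ _ := by
        rw [e2, ← neg_div_neg_eq, div_le_iff₀ (by linarith)]
        have : 0 ≤ T ^ (1 - (N : ℝ) / 2) := Real.rpow_nonneg (hm0.le.trans hmT) _
        have h2 : 2 / ((N : ℝ) - 2) * m ^ (1 - (N : ℝ) / 2) * -(1 - (N : ℝ) / 2)
            = m ^ (1 - (N : ℝ) / 2) := by
          have : (N : ℝ) - 2 ≠ 0 := by linarith
          field_simp
          ring
        rw [h2]
        linarith

theorem isTest_potential (hδ : 0 < δ) (hθ : ContDiff ℝ ∞ θ) (h0 : ∀ t < δ, θ t = 0)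
    (h1 : ∀ t, T < t → θ t = 0) :
    IsTest fun x : Sp N => potential N θ T (‖x‖ ^ 2) := by
  refine ⟨(contDiff_potential hδ hθ h0).comp (contDiff_norm_sq ℝ), ?_⟩
  refine HasCompactSupport.intro (isCompact_closedBall (0 : Sp N) (√T)) fun x hx => ?_
  refine potential_eq_zero h1 ?_
  rw [mem_closedBall_zero_iff, not_le] at hx
  exact (Real.sqrt_le_left (norm_nonneg x)).1 hx.le

/-- The radial Laplacian is 4t^{1−N/2}(t^{N/2}φ')', and the potential is built so that t^{N/2}φ' =
θ. -/
theorem laplacian_potential (hδ : 0 < δ) (hθ : ContDiff ℝ ∞ θ) (h0 : ∀ t < δ, θ t = 0)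
    {x : Sp N} (hx : x ≠ 0) :
    Laplacian.laplacian (fun x : Sp N => potential N θ T (‖x‖ ^ 2)) x
      = 4 * (‖x‖ ^ 2) ^ (1 - (N : ℝ) / 2) * deriv θ (‖x‖ ^ 2) := by
  have hx0 : 0 < ‖x‖ ^ 2 := by positivity
  rw [laplacian_comp_norm_sq (contDiff_potential hδ hθ h0), deriv_potential hδ hθ h0]
  set t := ‖x‖ ^ 2
  have h2 : HasDerivAt (fun t : ℝ => t ^ (-((N : ℝ) / 2)) * θ t)
      (-((N : ℝ) / 2) * t ^ (-((N : ℝ) / 2) - 1) * θ t + t ^ (-((N : ℝ) / 2)) * deriv θ t) t :=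
    (Real.hasDerivAt_rpow_const (Or.inl hx0.ne')).mul
      (hθ.differentiable (by simp)).differentiableAt.hasDerivAt
  rw [h2.deriv, Real.rpow_sub_one hx0.ne', show 1 - (N : ℝ) / 2 = -((N : ℝ) / 2) + 1 by ring,
    Real.rpow_add_one hx0.ne']
  field_simp
  ring

end RadialTest

/-! ### Balls described by |x|² < T. -/

section SqBall

theorem measurableSet_norm_sq_lt (N : ℕ) (T : ℝ) : MeasurableSet {y : Sp N | ‖y‖ ^ 2 < T} :=
  measurableSet_lt (by fun_prop) measurable_const

theorem norm_sq_lt_subset (N : ℕ) (T : ℝ) :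
    {y : Sp N | ‖y‖ ^ 2 < T} ⊆ Metric.closedBall 0 (√T) := fun y hy => by
  rw [mem_closedBall_zero_iff]
  exact Real.le_sqrt_of_sq_le (le_of_lt hy)

theorem integrableOn_norm_sq_lt {N : ℕ} {f : Sp N → ℝ} (hf : LocallyIntegrable f) (T : ℝ) :
    IntegrableOn f {y : Sp N | ‖y‖ ^ 2 < T} :=
  (hf.integrableOn_isCompact (isCompact_closedBall _ _)).mono_set (norm_sq_lt_subset N T)

end SqBall

/-! ### The weak equation tested against radial potentials. -/

section WeakForm

variable {N : ℕ} [Fact (4 ≤ N)] {u f : Sp N → ℝ} {V θ : ℝ → ℝ} {δ T : ℝ}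

/-- The normalisation constant of the fundamental solution of the Laplacian. -/
noncomputable def newtonConst (N : ℕ) : ℝ := 1 / (((N : ℝ) - 2) * (N * unitBallVolume N))

theorem newtonConst_pos (N : ℕ) [Fact (4 ≤ N)] : 0 < newtonConst N := by
  have := four_le_cast N
  have := unitBallVolume_pos N
  have : 0 < (N : ℝ) - 2 := by linarith
  unfold newtonConst
  positivity

theorem max_rpow_le (hδ : 0 < δ) (t : ℝ) :
    max t δ ^ (1 - (N : ℝ) / 2) ≤ δ ^ (1 - (N : ℝ) / 2) := by
  have := four_le_cast N
  exact Real.rpow_le_rpow_of_nonpos hδ (le_max_right _ _) (by linarith)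

theorem integrableOn_mul_max_rpow (hδ : 0 < δ) (hf : LocallyIntegrable f) (T : ℝ) :
    IntegrableOn (fun y : Sp N => |f y| * max (‖y‖ ^ 2) δ ^ (1 - (N : ℝ) / 2))
      {y : Sp N | ‖y‖ ^ 2 < T} := by
  refine Integrable.mul_bdd (c := δ ^ (1 - (N : ℝ) / 2)) (integrableOn_norm_sq_lt hf T).abs
    (Measurable.aestronglyMeasurable (by fun_prop)) (ae_of_all _ fun y => ?_)
  rw [Real.norm_of_nonneg (Real.rpow_nonneg (hδ.le.trans (le_max_right _ _)) _)]
  exact max_rpow_le hδ _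

/-- On the left, t^{1−N/2} in the Laplacian of the potential cancels the polar Jacobian and leaves
∫θ'V. On the right, only |θ| ≤ 1 enters, not the size of θ', so θ' may later concentrate at a point.
-/
theorem abs_integral_deriv_mul_le (hu : ∀ᵐ x, u x = V (‖x‖ ^ 2)) (hf : IsWeakLaplacian u f)
    (hδ : 0 < δ) (hδT : δ ≤ T) (hθ : ContDiff ℝ ∞ θ) (h0 : ∀ t < δ, θ t = 0)
    (h1 : ∀ t, T < t → θ t = 0) (hb : ∀ t, |θ t| ≤ 1) :
    |∫ t in Set.Ioi 0, deriv θ t * V t| ≤ newtonConst N *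
      ∫ y in {y : Sp N | ‖y‖ ^ 2 < T}, |f y| * max (‖y‖ ^ 2) δ ^ (1 - (N : ℝ) / 2) := by
  have := nontrivial_Sp N
  have hN := four_le_cast N
  have hV := unitBallVolume_pos N
  have key := hf.2.2 _ (isTest_potential (N := N) hδ hθ h0 h1)
  have eL : ∫ x : Sp N, Laplacian.laplacian (fun x : Sp N => potential N θ T (‖x‖ ^ 2)) x * u x
      = 2 * (N * unitBallVolume N) * ∫ t in Set.Ioi 0, deriv θ t * V t := by
    have e1 : ∫ x : Sp N, Laplacian.laplacian (fun x : Sp N => potential N θ T (‖x‖ ^ 2)) x * u x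
        = ∫ x : Sp N, (fun t => 4 * t ^ (1 - (N : ℝ) / 2) * deriv θ t * V t) (‖x‖ ^ 2) := by
      refine integral_congr_ae ?_
      filter_upwards [hu, Measure.ae_ne volume (0 : Sp N)] with x hx hx0
      rw [hx, laplacian_potential hδ hθ h0 hx0]
    have e2 : Set.EqOn (fun t : ℝ => t ^ ((N : ℝ) / 2 - 1) *
        (4 * t ^ (1 - (N : ℝ) / 2) * deriv θ t * V t)) (fun t => 4 * (deriv θ t * V t))
        (Set.Ioi 0) := fun t ht => by
      have : t ^ ((N : ℝ) / 2 - 1) * t ^ (1 - (N : ℝ) / 2) = 1 := by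
        rw [← Real.rpow_add ht]; simp
      linear_combination 4 * deriv θ t * V t * this
    rw [e1, integral_comp_norm_sq
      (fun t => 4 * t ^ (1 - (N : ℝ) / 2) * deriv θ t * V t),
      setIntegral_congr_fun measurableSet_Ioi e2, integral_const_mul]
    ring
  have eR : |∫ x, potential N θ T (‖x‖ ^ 2) * f x| ≤ 2 / ((N : ℝ) - 2) *
      ∫ y in {y : Sp N | ‖y‖ ^ 2 < T}, |f y| * max (‖y‖ ^ 2) δ ^ (1 - (N : ℝ) / 2) := by
    have hz : ∀ x : Sp N, x ∉ {y : Sp N | ‖y‖ ^ 2 < T} → potential N θ T (‖x‖ ^ 2) * f x = 0 :=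
      fun x hx => by rw [potential_eq_zero h1 (not_lt.1 hx), zero_mul]
    rw [← setIntegral_eq_integral_of_forall_compl_eq_zero hz, ← integral_const_mul,
      ← Real.norm_eq_abs]
    refine norm_integral_le_of_norm_le ((integrableOn_mul_max_rpow hδ hf.2.1 T).const_mul _) ?_
    refine (ae_restrict_iff' (measurableSet_norm_sq_lt N T)).2 (ae_of_all _ fun x hx => ?_)
    rw [Real.norm_eq_abs, abs_mul]
    calc _ ≤ 2 / ((N : ℝ) - 2) * max (‖x‖ ^ 2) δ ^ (1 - (N : ℝ) / 2) * |f x| := by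
          gcongr
          exact abs_potential_le hδ hδT hθ h0 hb (le_of_lt hx)
      _ = _ := by ring
  rw [← key, eL, abs_mul, abs_of_pos (by positivity), mul_comm,
    ← le_div_iff₀ (by positivity)] at eR
  refine eR.trans_eq ?_
  have : (N : ℝ) - 2 ≠ 0 := by linarith
  unfold newtonConst
  field_simp

end WeakForm
-- Comparing two averages of the profile.
section Density

/-- `a` is a smooth probability density on `ℝ` vanishing outside the interval `(δ, T)`. -/
structure IsSmoothDensity (δ T : ℝ) (a : ℝ → ℝ) : Prop where
  contDiff : ContDiff ℝ ∞ a
  nonneg : ∀ t, 0 ≤ a t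
  integrable : Integrable a
  integral_eq_one : ∫ t, a t = 1
  eq_zero : ∀ t, t ∉ Set.Ioo δ T → a t = 0

namespace IsSmoothDensity

variable {a b : ℝ → ℝ} {δ T : ℝ}

theorem cdf_of_lt (ha : IsSmoothDensity δ T a) {t : ℝ} (ht : t < δ) : ∫ s in δ..t, a s = 0 :=
  intervalIntegral.integral_zero_ae (ae_of_all _ fun s hs => by
    rw [Set.uIoc_of_ge ht.le] at hs
    exact ha.eq_zero s fun h' => absurd h'.1 (not_lt.2 hs.2))

theorem cdf_mem (ha : IsSmoothDensity δ T a) (t : ℝ) : (∫ s in δ..t, a s) ∈ Set.Icc (0 : ℝ) 1 := by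
  rcases lt_or_ge t δ with h | h
  · simp [ha.cdf_of_lt h]
  · refine ⟨intervalIntegral.integral_nonneg h fun s _ => ha.nonneg s, ?_⟩
    rw [intervalIntegral.integral_of_le h, ← ha.integral_eq_one]
    exact setIntegral_le_integral ha.integrable (ae_of_all _ ha.nonneg)

theorem cdf_of_gt (ha : IsSmoothDensity δ T a) (hδT : δ ≤ T) {t : ℝ} (ht : T < t) :
    ∫ s in δ..t, a s = 1 := by
  rw [intervalIntegral.integral_of_le (hδT.trans ht.le), ← ha.integral_eq_one]
  exact setIntegral_eq_integral_of_forall_compl_eq_zero fun s hs =>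
    ha.eq_zero s fun h' => hs ⟨h'.1, (h'.2.trans ht).le⟩

/-- Take θ to be the difference of the two distribution functions. Both are 0 below δ, 1 above T and
in [0,1] between, so θ is admissible however concentrated the densities are. -/
theorem abs_integral_sub_le {N : ℕ} [Fact (4 ≤ N)] {u f : Sp N → ℝ} {V : ℝ → ℝ}
    (ha : IsSmoothDensity δ T a) (hb : IsSmoothDensity δ T b)
    (hu : ∀ᵐ x, u x = V (‖x‖ ^ 2)) (hf : IsWeakLaplacian u f) (hδ : 0 < δ) (hδT : δ ≤ T) :
    |∫ t in Set.Ioi 0, (a t - b t) * V t| ≤ newtonConst N *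
      ∫ y in {y : Sp N | ‖y‖ ^ 2 < T}, |f y| * max (‖y‖ ^ 2) δ ^ (1 - (N : ℝ) / 2) := by
  have hc : Continuous fun t => a t - b t := ha.contDiff.continuous.sub hb.contDiff.continuous
  have hd : ∀ t, HasDerivAt (fun t => ∫ s in δ..t, (a s - b s)) (a t - b t) t := fun t =>
    intervalIntegral.integral_hasDerivAt_right (hc.intervalIntegrable _ _)
      (hc.stronglyMeasurableAtFilter _ _) hc.continuousAt
  have hd' : deriv (fun t => ∫ s in δ..t, (a s - b s)) = fun t => a t - b t :=
    funext fun t => (hd t).deriv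
  have hsub : ∀ t, ∫ s in δ..t, (a s - b s) = (∫ s in δ..t, a s) - ∫ s in δ..t, b s := fun t =>
    intervalIntegral.integral_sub (ha.contDiff.continuous.intervalIntegrable _ _)
      (hb.contDiff.continuous.intervalIntegrable _ _)
  have := abs_integral_deriv_mul_le (θ := fun t => ∫ s in δ..t, (a s - b s)) hu hf hδ hδT
    (contDiff_infty_iff_deriv.2 ⟨fun t => (hd t).differentiableAt, by
      rw [hd']
      exact ha.contDiff.sub hb.contDiff⟩)
    (fun t ht => by rw [hsub, ha.cdf_of_lt ht, hb.cdf_of_lt ht, sub_zero])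
    (fun t ht => by rw [hsub, ha.cdf_of_gt hδT ht, hb.cdf_of_gt hδT ht, sub_self])
    (fun t => by
      have h1 := ha.cdf_mem t
      have h2 := hb.cdf_mem t
      rw [hsub, abs_le]
      exact ⟨by linarith [h1.1, h2.2], by linarith [h1.2, h2.1]⟩)
  rwa [hd'] at this

theorem mono {δ' T' : ℝ} (ha : IsSmoothDensity δ T a) (h1 : δ' ≤ δ) (h2 : T ≤ T') :
    IsSmoothDensity δ' T' a :=
  ⟨ha.contDiff, ha.nonneg, ha.integrable, ha.integral_eq_one, fun t ht => ha.eq_zero t fun h =>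
    ht ⟨h1.trans_lt h.1, h.2.trans_le h2⟩⟩

theorem of_bump {c : ℝ} (φ : ContDiffBump c) :
    IsSmoothDensity (c - φ.rOut) (c + φ.rOut) (φ.normed volume) :=
  ⟨φ.contDiff_normed, φ.nonneg_normed, φ.integrable_normed, φ.integral_normed, fun t ht => by
    rw [← Real.ball_eq_Ioo, ← φ.support_normed_eq (μ := volume)] at ht
    exact Function.notMem_support.1 ht⟩

theorem of_bump_sub (t₀ : ℝ) (φ : ContDiffBump (0 : ℝ)) :
    IsSmoothDensity (t₀ - φ.rOut) (t₀ + φ.rOut) (fun s => φ.normed volume (t₀ - s)) := by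
  refine ⟨φ.contDiff_normed.comp (contDiff_const.sub contDiff_id), fun t => φ.nonneg_normed _,
    φ.integrable_normed.comp_sub_left t₀, ?_, fun t ht => ?_⟩
  · rw [integral_sub_left_eq_self (φ.normed volume) volume t₀, φ.integral_normed]
  · refine (of_bump φ).eq_zero _ fun h => ht ?_
    constructor <;> linarith [h.1, h.2]

theorem integral_mul_eq (ha : IsSmoothDensity δ T a) (hδ : 0 < δ) (V : ℝ → ℝ) :
    ∫ t in Set.Ioi 0, a t * V t = ∫ t, a t * (Set.Ioo δ T).indicator V t := by
  have h1 : ∀ t, t ∉ Set.Ioi (0 : ℝ) → a t * V t = 0 := fun t ht => by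
    rw [ha.eq_zero t fun h => ht (hδ.trans h.1), zero_mul]
  rw [setIntegral_eq_integral_of_forall_compl_eq_zero h1]
  congr 1 with t
  by_cases ht : t ∈ Set.Ioo δ T
  · rw [Set.indicator_of_mem ht]
  · rw [ha.eq_zero t ht, zero_mul, zero_mul]

theorem integrableOn_mul (ha : IsSmoothDensity δ T a) {C : ℝ} (hC : ∀ t, a t ≤ C) {V : ℝ → ℝ}
    (hV : IntegrableOn V (Set.Ioo δ T)) (s : Set ℝ) : IntegrableOn (fun t => a t * V t) s := by
  have h : Integrable fun t => a t * (Set.Ioo δ T).indicator V t :=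
    (hV.integrable_indicator measurableSet_Ioo).bdd_mul
      ha.contDiff.continuous.aestronglyMeasurable (ae_of_all _ fun t => by
        rw [Real.norm_of_nonneg (ha.nonneg t)]
        exact hC t)
  refine (h.congr (ae_of_all _ fun t => ?_)).integrableOn
  by_cases ht : t ∈ Set.Ioo δ T
  · simp only [Set.indicator_of_mem ht]
  · simp only [ha.eq_zero t ht, zero_mul]

end IsSmoothDensity

theorem bump_normed_le {c : ℝ} (φ : ContDiffBump c) (t : ℝ) :
    φ.normed volume t ≤ 1 / (2 * φ.rIn) := by
  have := φ.normed_le_div_measure_closedBall_rIn volume t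
  rwa [Measure.real, Real.volume_closedBall, ENNReal.toReal_ofReal
    (by have := φ.rIn_pos; positivity)] at this

end Density

/-! ### From averages to an almost everywhere bound. -/

section Pointwise

variable {N : ℕ} [Fact (4 ≤ N)] {u f : Sp N → ℝ} {V : ℝ → ℝ} {δ T : ℝ}

/-- On (δ, T) the Jacobian is at least δ^{N/2−1}, so local integrability of u passes to its profile.
-/
theorem integrableOn_profile (hu : ∀ᵐ x, u x = V (‖x‖ ^ 2)) (hui : LocallyIntegrable u)
    (hδ : 0 < δ) (T : ℝ) :
    IntegrableOn V (Set.Ioo δ T) ∧ N * unitBallVolume N / 2 * ∫ t in Set.Ioo δ T, |V t| ≤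
      δ ^ (1 - (N : ℝ) / 2) * ∫ y in {y : Sp N | ‖y‖ ^ 2 < T}, |u y| := by
  have hN := four_le_cast N
  let F : ℝ → ℝ := (Set.Ioo δ T).indicator fun t => t ^ (1 - (N : ℝ) / 2) * V t
  have hS : MeasurableSet {y : Sp N | ‖y‖ ^ 2 ∈ Set.Ioo δ T} :=
    measurableSet_Ioo.preimage (by fun_prop)
  have hFu : (fun x : Sp N => F (‖x‖ ^ 2)) =ᵐ[volume] {y : Sp N | ‖y‖ ^ 2 ∈ Set.Ioo δ T}.indicator
      fun x => (‖x‖ ^ 2) ^ (1 - (N : ℝ) / 2) * u x := by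
    filter_upwards [hu] with x hx
    by_cases h : ‖x‖ ^ 2 ∈ Set.Ioo δ T
    · rw [Set.indicator_of_mem (by exact h), hx]
      simp only [F, Set.indicator_of_mem h]
    · rw [Set.indicator_of_notMem (by exact h)]
      simp only [F, Set.indicator_of_notMem h]
  have hsub : {y : Sp N | ‖y‖ ^ 2 ∈ Set.Ioo δ T} ⊆ {y : Sp N | ‖y‖ ^ 2 < T} := fun y hy => hy.2
  have hr : ∀ x ∈ {y : Sp N | ‖y‖ ^ 2 ∈ Set.Ioo δ T},
      (‖x‖ ^ 2) ^ (1 - (N : ℝ) / 2) ≤ δ ^ (1 - (N : ℝ) / 2) := fun x hx =>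
    Real.rpow_le_rpow_of_nonpos hδ hx.1.le (by linarith)
  have hi : Integrable fun x : Sp N => F (‖x‖ ^ 2) := by
    refine Integrable.congr ?_ hFu.symm
    refine (integrable_indicator_iff hS).2 ?_
    refine Integrable.bdd_mul (c := δ ^ (1 - (N : ℝ) / 2))
      ((integrableOn_norm_sq_lt hui T).mono_set hsub)
      (Measurable.aestronglyMeasurable (by fun_prop)) ?_
    refine (ae_restrict_iff' hS).2 (ae_of_all _ fun x hx => ?_)
    rw [Real.norm_of_nonneg (by positivity)]
    exact hr x hx
  have hF : ∀ t : ℝ, 0 < t → t ^ ((N : ℝ) / 2 - 1) * F t = (Set.Ioo δ T).indicator V t := by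
    intro t ht
    by_cases h : t ∈ Set.Ioo δ T
    · simp only [F, Set.indicator_of_mem h]
      rw [← mul_assoc, ← Real.rpow_add ht]
      simp
    · simp only [F, Set.indicator_of_notMem h, mul_zero]
  have hsub' : Set.Ioo δ T ⊆ Set.Ioi 0 := fun t ht => hδ.trans ht.1
  refine ⟨?_, ?_⟩
  · have h1 := integrable_comp_norm_sq.1 hi
    refine (h1.mono_set hsub').congr_fun (fun t ht => ?_) measurableSet_Ioo
    exact (hF t (hsub' ht)).trans (Set.indicator_of_mem ht _)
  · have h1 : ∫ t in Set.Ioo δ T, |V t|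
        = ∫ t in Set.Ioi 0, t ^ ((N : ℝ) / 2 - 1) * |F t| := by
      rw [← integral_indicator measurableSet_Ioo, ← setIntegral_eq_integral_of_forall_compl_eq_zero
        (s := Set.Ioi 0) fun t ht => Set.indicator_of_notMem (fun h => ht (hsub' h)) _]
      refine setIntegral_congr_fun measurableSet_Ioi fun t ht => ?_
      have := congrArg abs (hF t ht)
      rw [abs_mul, abs_of_nonneg (Real.rpow_nonneg (le_of_lt ht) _)] at this
      simp only [this]
      exact (norm_indicator_eq_indicator_norm V t).symm
    rw [h1, ← integral_comp_norm_sq fun t => |F t|, ← integral_const_mul]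
    have h2 : (fun x : Sp N => |F (‖x‖ ^ 2)|) =ᵐ[volume]
        {y : Sp N | ‖y‖ ^ 2 ∈ Set.Ioo δ T}.indicator
          fun x => (‖x‖ ^ 2) ^ (1 - (N : ℝ) / 2) * |u x| := by
      filter_upwards [hFu] with x hx
      rw [hx]
      by_cases h : x ∈ {y : Sp N | ‖y‖ ^ 2 ∈ Set.Ioo δ T}
      · rw [Set.indicator_of_mem h, Set.indicator_of_mem h, abs_mul,
          abs_of_nonneg (Real.rpow_nonneg (by positivity) _)]
      · rw [Set.indicator_of_notMem h, Set.indicator_of_notMem h, abs_zero]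
    have h3 := (integrableOn_norm_sq_lt hui T).abs.const_mul (δ ^ (1 - (N : ℝ) / 2))
    rw [integral_congr_ae h2, ← integral_indicator (measurableSet_norm_sq_lt N T)]
    refine integral_mono (hi.abs.congr h2)
      ((integrable_indicator_iff (measurableSet_norm_sq_lt N T)).2 h3) fun x => ?_
    by_cases h : x ∈ {y : Sp N | ‖y‖ ^ 2 ∈ Set.Ioo δ T}
    · rw [Set.indicator_of_mem h, Set.indicator_of_mem (hsub h)]
      exact mul_le_mul_of_nonneg_right (hr x h) (abs_nonneg _)
    · rw [Set.indicator_of_notMem h]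
      exact Set.indicator_nonneg (fun y _ => by positivity) _

/-- The constant in front of the mean of `|u|` in the pointwise estimate. -/
noncomputable def meanConst (N : ℕ) (T : ℝ) : ℝ :=
  4 / T * (2 / (N * unitBallVolume N) * (T / 2) ^ (1 - (N : ℝ) / 2))

/-- Averages of V against bumps shrinking to t converge to V(t) for a.e. t by Lebesgue
differentiation. Each differs from the average against one fixed bump near T by at most the
Laplacian term, uniformly in the shrinking radius. -/
theorem ae_abs_le (hu : ∀ᵐ x, u x = V (‖x‖ ^ 2)) (hf : IsWeakLaplacian u f)
    (hδ : 0 < δ) (hδT : δ ≤ T / 2) :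
    ∀ᵐ x : Sp N, ‖x‖ ^ 2 ∈ Set.Ioo δ T →
      |u x| ≤ meanConst N T * (∫ y in {y : Sp N | ‖y‖ ^ 2 < T}, |u y|) + newtonConst N *
        ∫ y in {y : Sp N | ‖y‖ ^ 2 < T}, |f y| * max (‖y‖ ^ 2) δ ^ (1 - (N : ℝ) / 2) := by
  have hN := four_le_cast N
  have hV0 := unitBallVolume_pos N
  have hT : 0 < T := by linarith
  set B := newtonConst N *
    ∫ y in {y : Sp N | ‖y‖ ^ 2 < T}, |f y| * max (‖y‖ ^ 2) δ ^ (1 - (N : ℝ) / 2) with hB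
  set A := meanConst N T * (∫ y in {y : Sp N | ‖y‖ ^ 2 < T}, |u y|) with hA
  obtain ⟨hVi, -⟩ := integrableOn_profile hu hf.1 hδ T
  -- Outer radius T/4 places the support in (T/2, T). Inner radius T/8 bounds the density by 4/T,
  -- the factor appearing in `meanConst`.
  let β : ContDiffBump (3 * T / 4) := ⟨T / 8, T / 4, by positivity, by linarith⟩
  have hβ' : IsSmoothDensity (T / 2) T (β.normed volume) :=
    (IsSmoothDensity.of_bump β).mono (by simp only [β]; linarith) (by simp only [β]; linarith)
  have hβ := hβ'.mono hδT le_rfl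
  have hβV : |∫ t in Set.Ioi 0, β.normed volume t * V t| ≤ A := by
    obtain ⟨hVi', hVb⟩ := integrableOn_profile hu hf.1 (half_pos hT) T
    rw [hβ'.integral_mul_eq (half_pos hT), ← Real.norm_eq_abs]
    have hle : ∀ t, ‖β.normed volume t * (Set.Ioo (T / 2) T).indicator V t‖
        ≤ 4 / T * (Set.Ioo (T / 2) T).indicator (fun t => |V t|) t := fun t => by
      rw [norm_mul, Real.norm_of_nonneg (β.nonneg_normed t), norm_indicator_eq_indicator_norm]
      refine mul_le_mul_of_nonneg_right ((bump_normed_le β t).trans_eq ?_)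
        (Set.indicator_nonneg (fun _ _ => abs_nonneg _) _)
      simp only [β]
      field_simp
      norm_num
    refine (norm_integral_le_of_norm_le
      (((integrable_indicator_iff measurableSet_Ioo).2 hVi'.abs).const_mul _)
      (ae_of_all _ hle)).trans ?_
    rw [integral_const_mul, integral_indicator measurableSet_Ioo, hA, meanConst, mul_assoc,
      mul_assoc]
    gcongr
    rw [div_mul_eq_mul_div, le_div_iff₀ (by positivity)]
    linarith
  have main : ∀ᵐ t : ℝ, 0 < t → t ∈ Set.Ioo δ T → |V t| ≤ A + B := by
    let φ : ℕ → ContDiffBump (0 : ℝ) := fun n =>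
      ⟨1 / (n + 1) / 2, 1 / (n + 1), by positivity, half_lt_self (by positivity)⟩
    have hφ : Tendsto (fun n => (φ n).rOut) atTop (𝓝 0) :=
      tendsto_one_div_add_atTop_nhds_zero_nat
    -- The constant K = 2 is the ratio of outer to inner radius of the bumps `φ n`.
    have hconv := ContDiffBump.ae_convolution_tendsto_right_of_locallyIntegrable (μ := volume)
      (K := 2) hφ (Eventually.of_forall fun n => by simp only [φ]; linarith)
      (hVi.integrable_indicator measurableSet_Ioo).locallyIntegrable
    filter_upwards [hconv] with t ht ht0 htm
    rw [Set.indicator_of_mem htm] at ht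
    refine le_of_tendsto ht.abs ?_
    filter_upwards [hφ.eventually_lt_const (sub_pos.2 htm.1),
      hφ.eventually_lt_const (sub_pos.2 htm.2)] with n h1 h2
    have ha : IsSmoothDensity δ T fun s => (φ n).normed volume (t - s) :=
      (IsSmoothDensity.of_bump_sub t (φ n)).mono (by linarith) (by linarith)
    have hd := ha.abs_integral_sub_le hβ hu hf hδ (by linarith)
    simp only [sub_mul] at hd
    rw [integral_sub (ha.integrableOn_mul (fun s => bump_normed_le (φ n) _) hVi _)
      (hβ.integrableOn_mul (bump_normed_le β) hVi _), ha.integral_mul_eq hδ, ← hB] at hd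
    rw [convolution_eq_swap]
    simp only [ContinuousLinearMap.lsmul_apply, smul_eq_mul]
    have h3 := abs_sub_abs_le_abs_sub (∫ s, (φ n).normed volume (t - s) *
      (Set.Ioo δ T).indicator V s) (∫ s in Set.Ioi 0, β.normed volume s * V s)
    linarith
  filter_upwards [hu, ae_norm_sq (N := N) main] with x hx hx'
  rw [hx]
  exact hx'

end Pointwise
-- Hölder's inequality for the exponents N/2 and N/(N−2).
section Holder

theorem integral_mul_le_of_integrable_rpow {X : Type*} [MeasurableSpace X] {μ : Measure X}
    {p q : ℝ} (hpq : p.HolderConjugate q) {f g : X → ℝ} (hf0 : 0 ≤ᵐ[μ] f) (hg0 : 0 ≤ᵐ[μ] g)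
    (hfm : AEStronglyMeasurable f μ) (hgm : AEStronglyMeasurable g μ)
    (hfi : Integrable (fun x => f x ^ p) μ) (hgi : Integrable (fun x => g x ^ q) μ) :
    ∫ x, f x * g x ∂μ ≤ (∫ x, f x ^ p ∂μ) ^ (1 / p) * (∫ x, g x ^ q ∂μ) ^ (1 / q) := by
  have key : ∀ {r : ℝ} {h : X → ℝ}, 0 < r → 0 ≤ᵐ[μ] h → AEStronglyMeasurable h μ →
      Integrable (fun x => h x ^ r) μ → MemLp h (ENNReal.ofReal r) μ := by
    intro r h hr h0 hm hi
    refine (integrable_norm_rpow_iff hm (by simpa using hr) ENNReal.ofReal_ne_top).1 ?_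
    rw [ENNReal.toReal_ofReal hr.le]
    refine hi.congr ?_
    filter_upwards [h0] with x hx
    rw [Real.norm_of_nonneg hx]
  exact integral_mul_le_Lp_mul_Lq_of_nonneg hpq hf0 hg0 (key hpq.pos hf0 hfm hfi)
    (key hpq.symm.pos hg0 hgm hgi)

theorem holderConjugate (N : ℕ) [Fact (4 ≤ N)] :
    ((N : ℝ) / 2).HolderConjugate ((N : ℝ) / ((N : ℝ) - 2)) := by
  have hN := four_le_cast N
  have : (N : ℝ) - 2 ≠ 0 := by linarith
  rw [Real.holderConjugate_iff]
  refine ⟨by linarith, ?_⟩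
  field_simp
  ring

end Holder

/-! ### Polar coordinates and Hölder's inequality on balls. -/

section PolarBall

variable {N : ℕ} [Fact (4 ≤ N)] {F : ℝ → ℝ} {T : ℝ}

theorem integrableOn_comp_norm_sq :
    IntegrableOn (fun x : Sp N => F (‖x‖ ^ 2)) {x : Sp N | ‖x‖ ^ 2 < T} ↔
      IntegrableOn (fun t => t ^ ((N : ℝ) / 2 - 1) * F t) (Set.Ioo 0 T) := by
  have h1 : {x : Sp N | ‖x‖ ^ 2 < T}.indicator (fun x => F (‖x‖ ^ 2))
      = fun x => (Set.Iio T).indicator F (‖x‖ ^ 2) := by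
    ext x
    simp [Set.indicator]
  have h2 : (fun t : ℝ => t ^ ((N : ℝ) / 2 - 1) * (Set.Iio T).indicator F t)
      = (Set.Iio T).indicator fun t => t ^ ((N : ℝ) / 2 - 1) * F t := by
    ext t
    simp [Set.indicator]
  rw [← integrable_indicator_iff (measurableSet_norm_sq_lt N T), h1, integrable_comp_norm_sq, h2,
    IntegrableOn, integrable_indicator_iff measurableSet_Iio, IntegrableOn,
    Measure.restrict_restrict measurableSet_Iio, Set.inter_comm, Set.Ioi_inter_Iio]
  rfl

theorem setIntegral_comp_norm_sq (F : ℝ → ℝ) (hT : 0 ≤ T) :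
    ∫ x in {x : Sp N | ‖x‖ ^ 2 < T}, F (‖x‖ ^ 2) = N * unitBallVolume N / 2 *
      ∫ t in (0 : ℝ)..T, t ^ ((N : ℝ) / 2 - 1) * F t := by
  have h1 : {x : Sp N | ‖x‖ ^ 2 < T}.indicator (fun x => F (‖x‖ ^ 2))
      = fun x => (Set.Iio T).indicator F (‖x‖ ^ 2) := by
    ext x
    simp [Set.indicator]
  have h2 : (fun t : ℝ => t ^ ((N : ℝ) / 2 - 1) * (Set.Iio T).indicator F t)
      = (Set.Iio T).indicator fun t => t ^ ((N : ℝ) / 2 - 1) * F t := by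
    ext t
    simp [Set.indicator]
  rw [← integral_indicator (measurableSet_norm_sq_lt N T), h1,
    integral_comp_norm_sq ((Set.Iio T).indicator F), h2,
    integral_indicator measurableSet_Iio, Measure.restrict_restrict measurableSet_Iio,
    Set.inter_comm, Set.Ioi_inter_Iio, intervalIntegral.integral_of_le hT,
    integral_Ioc_eq_integral_Ioo]

theorem integral_one_norm_sq_lt (hT : 0 ≤ T) :
    ∫ _ in {x : Sp N | ‖x‖ ^ 2 < T}, (1 : ℝ) = unitBallVolume N * T ^ ((N : ℝ) / 2) := by
  have hN := four_le_cast N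
  rw [setIntegral_comp_norm_sq (fun _ => 1) hT]
  simp only [mul_one]
  rw [integral_rpow (Or.inl (by linarith)), sub_add_cancel, Real.zero_rpow (by linarith)]
  field_simp
  ring

theorem volume_norm_sq_lt_lt_top (N : ℕ) (T : ℝ) : volume {x : Sp N | ‖x‖ ^ 2 < T} < ⊤ :=
  (measure_mono (norm_sq_lt_subset N T)).trans_lt measure_closedBall_lt_top

theorem setIntegral_abs_le {f : Sp N → ℝ} (hf : AEStronglyMeasurable f)
    (hfi : Integrable fun x => |f x| ^ ((N : ℝ) / 2)) (hT : 0 ≤ T) :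
    ∫ y in {y : Sp N | ‖y‖ ^ 2 < T}, |f y| ≤ unitBallVolume N ^ (1 - 2 / (N : ℝ)) *
      T ^ ((N : ℝ) / 2 - 1) * (∫ x, |f x| ^ ((N : ℝ) / 2)) ^ (2 / (N : ℝ)) := by
  have hN := four_le_cast N
  have hV := unitBallVolume_pos N
  have : IsFiniteMeasure (volume.restrict {x : Sp N | ‖x‖ ^ 2 < T}) :=
    ⟨by simpa using volume_norm_sq_lt_lt_top N T⟩
  have h := integral_mul_le_of_integrable_rpow (holderConjugate N)
    (μ := volume.restrict {x : Sp N | ‖x‖ ^ 2 < T}) (f := fun x => |f x|) (g := fun _ => 1)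
    (ae_of_all _ fun _ => abs_nonneg _) (ae_of_all _ fun _ => zero_le_one)
    hf.norm.restrict aestronglyMeasurable_const hfi.integrableOn (integrable_const _)
  simp only [mul_one, Real.one_rpow] at h
  rw [integral_one_norm_sq_lt hT, Real.mul_rpow hV.le (by positivity), ← Real.rpow_mul hT] at h
  have e1 : 1 / ((N : ℝ) / ((N : ℝ) - 2)) = 1 - 2 / (N : ℝ) := by
    have : (N : ℝ) - 2 ≠ 0 := by linarith
    field_simp
  have e2 : (N : ℝ) / 2 * (1 - 2 / (N : ℝ)) = (N : ℝ) / 2 - 1 := by field_simp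
  rw [e1, e2, one_div_div] at h
  refine h.trans ?_
  rw [mul_comm]
  refine mul_le_mul_of_nonneg_left (Real.rpow_le_rpow (integral_nonneg fun x => by positivity)
    (setIntegral_le_integral hfi (ae_of_all _ fun x => ?_)) (by positivity)) (by positivity)
  exact Real.rpow_nonneg (abs_nonneg _) _

end PolarBall

/-! ### The logarithmic weight and its dual integral. -/

section LogWeight

/-- `log (e / |x|)` as a function of `t = |x|²`. -/
noncomputable def logSq (t : ℝ) : ℝ := 1 - Real.log t / 2

theorem one_le_logSq {t : ℝ} (h0 : 0 ≤ t) (h1 : t ≤ 1) : 1 ≤ logSq t := by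
  have := Real.log_nonpos h0 h1
  unfold logSq
  linarith

theorem logSq_anti {s t : ℝ} (hs : 0 < s) (h : s ≤ t) : logSq t ≤ logSq s := by
  have := Real.log_le_log hs h
  unfold logSq
  linarith

theorem measurable_logSq : Measurable logSq := by
  unfold logSq
  fun_prop

theorem weight_eq_logSq {N : ℕ} {β : ℝ} (χ : WeightProfile N) {x : Sp N} (hx : x ≠ 0)
    (h1 : ‖x‖ ^ 2 < 1) :
    weight β χ x = logSq (‖x‖ ^ 2) ^ (β * ((N : ℝ) / 2 - 1)) := by
  have hx' : ‖x‖ ≠ 0 := norm_ne_zero_iff.2 hx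
  have hlt : ‖x‖ < 1 := by
    by_contra h
    nlinarith
  rw [weight, if_pos hlt, Real.log_div (Real.exp_ne_zero 1) hx', Real.log_exp, logSq, Real.log_pow]
  congr 1
  push_cast
  ring

variable {N : ℕ} [Fact (4 ≤ N)] {β δ T : ℝ}

theorem one_le_weight (hβ : 0 ≤ β) (χ : WeightProfile N) {x : Sp N} (hx : x ≠ 0) :
    1 ≤ weight β χ x := by
  have hN := four_le_cast N
  by_cases h : ‖x‖ ^ 2 < 1
  · rw [weight_eq_logSq χ hx h]
    exact Real.one_le_rpow (one_le_logSq (by positivity) h.le)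
      (mul_nonneg hβ (by linarith))
  · have : ¬ ‖x‖ < 1 := fun h' => h (by nlinarith [norm_nonneg x])
    rw [weight, if_neg this]
    exact χ.one_le _ (not_lt.1 this)

theorem integrableOn_max_rpow_mul_logSq (hβ : 0 ≤ β) (hδ : 0 < δ) (hT : T ≤ 1) :
    IntegrableOn (fun x : Sp N => max (‖x‖ ^ 2) δ ^ (-((N : ℝ) / 2)) * logSq (‖x‖ ^ 2) ^ (-β))
      {x : Sp N | ‖x‖ ^ 2 < T} := by
  have hN := four_le_cast N
  refine Measure.integrableOn_of_bounded (M := δ ^ (-((N : ℝ) / 2)))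
    (volume_norm_sq_lt_lt_top N T).ne (Measurable.aestronglyMeasurable ?_) ?_
  · exact Measurable.mul (by fun_prop)
      ((measurable_logSq.comp (by fun_prop)).pow_const _)
  · refine (ae_restrict_iff' (measurableSet_norm_sq_lt N T)).2 (ae_of_all _ fun x hx => ?_)
    have h1 : 1 ≤ logSq (‖x‖ ^ 2) := one_le_logSq (by positivity) (le_of_lt (lt_of_lt_of_le hx hT))
    have h2 : 0 < max (‖x‖ ^ 2) δ := hδ.trans_le (le_max_right _ _)
    rw [Real.norm_of_nonneg
      (mul_nonneg (Real.rpow_nonneg h2.le _) (Real.rpow_nonneg (by linarith) _))]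
    exact (mul_le_mul (Real.rpow_le_rpow_of_nonpos hδ (le_max_right _ _) (by linarith))
      (Real.rpow_le_one_of_one_le_of_nonpos h1 (by linarith)) (Real.rpow_nonneg (by linarith) _)
      (by positivity)).trans_eq (mul_one _)

theorem integral_inv_mul_logSq (hβ1 : β < 1) (hδ : 0 < δ) (hδT : δ ≤ T) (hT : T ≤ 1) :
    ∫ t in δ..T, t⁻¹ * logSq t ^ (-β)
      = 2 / (1 - β) * (logSq δ ^ (1 - β) - logSq T ^ (1 - β)) := by
  have hpos : ∀ t ∈ Set.uIcc δ T, 0 < t ∧ 1 ≤ logSq t := fun t ht => by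
    rw [Set.uIcc_of_le hδT] at ht
    have h0 : 0 < t := hδ.trans_le ht.1
    exact ⟨h0, one_le_logSq h0.le (ht.2.trans hT)⟩
  have hd : ∀ t ∈ Set.uIcc δ T,
      HasDerivAt (fun t => -(2 / (1 - β)) * logSq t ^ (1 - β)) (t⁻¹ * logSq t ^ (-β)) t := by
    intro t ht
    obtain ⟨h0, h1⟩ := hpos t ht
    have hl : HasDerivAt logSq (-(t⁻¹ / 2)) t := by
      have := ((Real.hasDerivAt_log h0.ne').div_const 2).const_sub 1
      exact this
    have := (hl.rpow_const (p := 1 - β) (Or.inl (by linarith))).const_mul (-(2 / (1 - β)))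
    refine this.congr_deriv ?_
    have hb : 1 - β ≠ 0 := by linarith
    rw [show 1 - β - 1 = -β by ring]
    field_simp
  have hc : ContinuousOn (fun t => t⁻¹ * logSq t ^ (-β)) (Set.uIcc δ T) := by
    refine ContinuousOn.mul (continuousOn_inv₀.mono fun t ht => (hpos t ht).1.ne') ?_
    refine ContinuousOn.rpow_const ?_ fun t ht => Or.inl (by linarith [(hpos t ht).2])
    exact continuousOn_const.sub
      ((Real.continuousOn_log.mono fun t ht => (hpos t ht).1.ne').div_const _)
  rw [intervalIntegral.integral_eq_sub_of_hasDerivAt hd hc.intervalIntegrable]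
  ring

/-- In the t-integral, the range below δ contributes at most 2/N. This is absorbed by the negative
boundary term at T from the exact integral over (δ, T), so no additive constant spoils the leading
coefficient. -/
theorem setIntegral_max_rpow_mul_logSq_le (hβ : 0 ≤ β) (hβ1 : β < 1) (hδ : 0 < δ) (hδT : δ ≤ T)
    (hT : T ≤ 1) :
    ∫ x in {x : Sp N | ‖x‖ ^ 2 < T},
        max (‖x‖ ^ 2) δ ^ (-((N : ℝ) / 2)) * logSq (‖x‖ ^ 2) ^ (-β)
      ≤ N * unitBallVolume N / (1 - β) * logSq δ ^ (1 - β) := by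
  have hN := four_le_cast N
  have hV := unitBallVolume_pos N
  have hT0 : 0 ≤ T := hδ.le.trans hδT
  set G : ℝ → ℝ := fun t => t ^ ((N : ℝ) / 2 - 1) *
    (max t δ ^ (-((N : ℝ) / 2)) * logSq t ^ (-β)) with hG
  have hGi : IntervalIntegrable G volume 0 T := by
    rw [intervalIntegrable_iff_integrableOn_Ioo_of_le hT0]
    exact integrableOn_comp_norm_sq.1 (integrableOn_max_rpow_mul_logSq (N := N) hβ hδ hT)
  have hδm : δ ∈ Set.uIcc 0 T := by
    rw [Set.uIcc_of_le hT0]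
    exact ⟨hδ.le, hδT⟩
  have hG1 := hGi.mono_set (Set.uIcc_subset_uIcc Set.left_mem_uIcc hδm)
  have hG2 := hGi.mono_set (Set.uIcc_subset_uIcc hδm Set.right_mem_uIcc)
  have b1 : ∫ t in (0 : ℝ)..δ, G t ≤ 2 / N := by
    have : ∫ t in (0 : ℝ)..δ, t ^ ((N : ℝ) / 2 - 1) * δ ^ (-((N : ℝ) / 2)) = 2 / N := by
      rw [intervalIntegral.integral_mul_const, integral_rpow (Or.inl (by linarith)),
        sub_add_cancel, Real.zero_rpow (by linarith), sub_zero, Real.rpow_neg hδ.le]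
      have := (Real.rpow_pos_of_pos hδ ((N : ℝ) / 2)).ne'
      field_simp
    rw [← this]
    refine intervalIntegral.integral_mono_on hδ.le hG1
      ((intervalIntegral.intervalIntegrable_rpow' (by linarith)).mul_const _) fun t ht => ?_
    have h1 : 1 ≤ logSq t := one_le_logSq ht.1 (ht.2.trans (hδT.trans hT))
    simp only [hG, max_eq_right ht.2]
    refine mul_le_mul_of_nonneg_left ?_ (Real.rpow_nonneg ht.1 _)
    exact mul_le_of_le_one_right (by positivity)
      (Real.rpow_le_one_of_one_le_of_nonpos h1 (by linarith))
  have b2 : ∫ t in δ..T, G t = 2 / (1 - β) * (logSq δ ^ (1 - β) - logSq T ^ (1 - β)) := by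
    rw [← integral_inv_mul_logSq hβ1 hδ hδT hT]
    refine intervalIntegral.integral_congr fun t ht => ?_
    rw [Set.uIcc_of_le hδT] at ht
    simp only [hG, max_eq_left ht.1]
    rw [← mul_assoc, ← Real.rpow_add (hδ.trans_le ht.1),
      show (N : ℝ) / 2 - 1 + -((N : ℝ) / 2) = -1 by ring, Real.rpow_neg_one]
  have b3 : 1 ≤ logSq T ^ (1 - β) := Real.one_le_rpow (one_le_logSq hT0 hT) (by linarith)
  have b4 : 2 / (N : ℝ) ≤ 2 / (1 - β) * logSq T ^ (1 - β) := by
    rw [div_mul_eq_mul_div, div_le_div_iff₀ (by linarith) (by linarith)]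
    nlinarith
  rw [setIntegral_comp_norm_sq (fun t => max t δ ^ (-((N : ℝ) / 2)) * logSq t ^ (-β)) hT0,
    ← intervalIntegral.integral_add_adjacent_intervals hG1 hG2, b2]
  calc _ ≤ N * unitBallVolume N / 2 * (2 / (1 - β) * logSq δ ^ (1 - β)) := by
        gcongr
        rw [mul_sub]
        linarith
    _ = _ := by ring

theorem setIntegral_mul_max_rpow_le (χ : WeightProfile N) (hβ : 0 ≤ β) (hβ1 : β < 1)
    (hδ : 0 < δ) (hδT : δ ≤ T) (hT : T ≤ 1) {f : Sp N → ℝ} (hf : AEStronglyMeasurable f)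
    (hfi : Integrable fun x => |f x| ^ ((N : ℝ) / 2) * weight β χ x) :
    ∫ y in {y : Sp N | ‖y‖ ^ 2 < T}, |f y| * max (‖y‖ ^ 2) δ ^ (1 - (N : ℝ) / 2) ≤
      (∫ y in {y : Sp N | ‖y‖ ^ 2 < T}, |f y| ^ ((N : ℝ) / 2) * weight β χ y) ^ (2 / (N : ℝ)) *
        (N * unitBallVolume N / (1 - β) * logSq δ ^ (1 - β)) ^ (((N : ℝ) - 2) / N) := by
  have := nontrivial_Sp N
  have hN := four_le_cast N
  have hN2 : (N : ℝ) - 2 ≠ 0 := by linarith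
  set S := {y : Sp N | ‖y‖ ^ 2 < T} with hS
  -- Inserting the factor logSq^a · logSq^(−a) splits the weight: the N/2-th power of logSq^a is
  -- w_β, and the N/(N−2)-th power of logSq^(−a) is logSq^(−β).
  set a : ℝ := β * ((N : ℝ) / 2 - 1) * (2 / N) with ha
  have hSm : MeasurableSet S := measurableSet_norm_sq_lt N T
  have hL : ∀ᵐ y ∂volume.restrict S, y ≠ 0 ∧ ‖y‖ ^ 2 < 1 ∧ 1 ≤ logSq (‖y‖ ^ 2) := by
    filter_upwards [ae_restrict_of_ae (Measure.ae_ne volume (0 : Sp N)), ae_restrict_mem hSm]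
      with y hy hyS
    have h1 : ‖y‖ ^ 2 < 1 := lt_of_lt_of_le hyS hT
    exact ⟨hy, h1, one_le_logSq (by positivity) h1.le⟩
  have hm : ∀ y : Sp N, 0 < max (‖y‖ ^ 2) δ := fun y => hδ.trans_le (le_max_right _ _)
  have hmL : Measurable fun y : Sp N => logSq (‖y‖ ^ 2) := measurable_logSq.comp (by fun_prop)
  have e1 : (fun y => |f y| * max (‖y‖ ^ 2) δ ^ (1 - (N : ℝ) / 2)) =ᵐ[volume.restrict S]
      fun y => |f y| * logSq (‖y‖ ^ 2) ^ a *
        (max (‖y‖ ^ 2) δ ^ (1 - (N : ℝ) / 2) * logSq (‖y‖ ^ 2) ^ (-a)) := by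
    filter_upwards [hL] with y hy
    have : logSq (‖y‖ ^ 2) ^ a * logSq (‖y‖ ^ 2) ^ (-a) = 1 := by
      rw [← Real.rpow_add (by linarith [hy.2.2])]
      simp
    linear_combination -(|f y| * max (‖y‖ ^ 2) δ ^ (1 - (N : ℝ) / 2)) * this
  have e2 : (fun y => (|f y| * logSq (‖y‖ ^ 2) ^ a) ^ ((N : ℝ) / 2)) =ᵐ[volume.restrict S]
      fun y => |f y| ^ ((N : ℝ) / 2) * weight β χ y := by
    filter_upwards [hL] with y hy
    have h0 : 0 ≤ logSq (‖y‖ ^ 2) := by linarith [hy.2.2]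
    rw [weight_eq_logSq χ hy.1 hy.2.1, Real.mul_rpow (abs_nonneg _) (Real.rpow_nonneg h0 _),
      ← Real.rpow_mul h0]
    congr 2
    rw [ha]
    field_simp
  have e3 : (fun y : Sp N => (max (‖y‖ ^ 2) δ ^ (1 - (N : ℝ) / 2) * logSq (‖y‖ ^ 2) ^ (-a)) ^
      ((N : ℝ) / ((N : ℝ) - 2))) =ᵐ[volume.restrict S]
      fun y => max (‖y‖ ^ 2) δ ^ (-((N : ℝ) / 2)) * logSq (‖y‖ ^ 2) ^ (-β) := by
    filter_upwards [hL] with y hy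
    have h0 : 0 ≤ logSq (‖y‖ ^ 2) := by linarith [hy.2.2]
    rw [Real.mul_rpow (Real.rpow_nonneg (hm y).le _) (Real.rpow_nonneg h0 _),
      ← Real.rpow_mul h0, ← Real.rpow_mul (hm y).le]
    congr 2
    · field_simp
      ring
    · rw [ha]
      field_simp
  have h := integral_mul_le_of_integrable_rpow (holderConjugate N)
    (μ := volume.restrict S) (f := fun y => |f y| * logSq (‖y‖ ^ 2) ^ a)
    (g := fun y => max (‖y‖ ^ 2) δ ^ (1 - (N : ℝ) / 2) * logSq (‖y‖ ^ 2) ^ (-a))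
    (by
      filter_upwards [hL] with y hy
      exact mul_nonneg (abs_nonneg _) (Real.rpow_nonneg (by linarith [hy.2.2]) _))
    (by
      filter_upwards [hL] with y hy
      exact mul_nonneg (Real.rpow_nonneg (hm y).le _) (Real.rpow_nonneg (by linarith [hy.2.2]) _))
    (hf.norm.restrict.mul (hmL.pow_const _).aestronglyMeasurable)
    (Measurable.aestronglyMeasurable (Measurable.mul (by fun_prop) (hmL.pow_const _)))
    (hfi.integrableOn.congr e2.symm)
    ((integrableOn_max_rpow_mul_logSq hβ hδ hT).congr e3.symm)
  rw [integral_congr_ae e1]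
  refine h.trans ?_
  rw [integral_congr_ae e2, integral_congr_ae e3, one_div_div, one_div_div]
  gcongr
  · exact Real.rpow_nonneg (integral_nonneg_of_ae (by
      filter_upwards [hL] with y hy
      exact mul_nonneg (by positivity) (weight_pos β χ hy.1).le)) _
  · exact integral_nonneg_of_ae (by
      filter_upwards [hL] with y hy
      exact mul_nonneg (Real.rpow_nonneg (hm y).le _) (Real.rpow_nonneg (by linarith [hy.2.2]) _))
  · exact div_nonneg (by linarith) (by linarith)
  · exact setIntegral_max_rpow_mul_logSq_le hβ hβ1 hδ hδT hT

end LogWeight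
-- Pointwise estimates for elements of E.
section SpaceE

variable {N : ℕ} [Fact (4 ≤ N)] {β : ℝ} {χ : WeightProfile N}

theorem exists_profile (v : E β χ) : ∃ V : ℝ → ℝ, ∀ᵐ x, fn v x = V (‖x‖ ^ 2) := by
  obtain ⟨f, -, hf⟩ := v.2.1
  refine ⟨fun t => f (√t), ?_⟩
  filter_upwards [hf] with x hx
  rw [Real.sqrt_sq (norm_nonneg x)]
  exact hx

theorem isWeakLaplacian_lap (v : E β χ) : IsWeakLaplacian (fn v) (lap v) := v.2.2.2

theorem aestronglyMeasurable_fn (v : E β χ) : AEStronglyMeasurable (fn v) :=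
  (Lp.stronglyMeasurable _).aestronglyMeasurable

theorem aestronglyMeasurable_lap (v : E β χ) : AEStronglyMeasurable (lap v) :=
  (Lp.stronglyMeasurable (v : Triples β χ).snd.snd).aestronglyMeasurable

theorem Lp_integrable_rpow {F : Type*} [NormedAddCommGroup F] {μ : Measure (Sp N)}
    (f : Lp F (halfDim N) μ) : Integrable (fun x => ‖f x‖ ^ ((N : ℝ) / 2)) μ := by
  have h := (Lp.memLp f).integrable_norm_rpow
    (lt_of_lt_of_le one_pos (Fact.out : 1 ≤ halfDim N)).ne' (halfDim_ne_top N)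
  rwa [halfDim_toReal] at h

theorem integrable_abs_fn_rpow (v : E β χ) : Integrable fun x => |fn v x| ^ ((N : ℝ) / 2) :=
  Lp_integrable_rpow (v : Triples β χ).fst

theorem integrable_abs_lap_rpow_mul (v : E β χ) :
    Integrable fun x => |lap v x| ^ ((N : ℝ) / 2) * weight β χ x := by
  have := nontrivial_Sp N
  have h : Integrable (fun x => ‖lap v x‖ ^ ((N : ℝ) / 2))
      (volume.withDensity fun x => ENNReal.ofReal (weight β χ x)) :=
    Lp_integrable_rpow (v : Triples β χ).snd.snd
  rw [integrable_withDensity_iff_integrable_smul'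
    (measurable_weight β χ).ennreal_ofReal (by simp)] at h
  refine h.congr ?_
  filter_upwards [Measure.ae_ne volume (0 : Sp N)] with x hx
  rw [ENNReal.toReal_ofReal (weight_pos β χ hx).le, smul_eq_mul, mul_comm]
  rfl

theorem ae_weight_nonneg : ∀ᵐ x : Sp N, 0 ≤ weight β χ x := by
  have := nontrivial_Sp N
  filter_upwards [Measure.ae_ne volume (0 : Sp N)] with x hx
  exact (weight_pos β χ hx).le

theorem integral_lap_nonneg (v : E β χ) (μ : Measure (Sp N)) (hμ : μ ≪ volume) :
    0 ≤ ∫ x, |lap v x| ^ ((N : ℝ) / 2) * weight β χ x ∂μ := by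
  refine integral_nonneg_of_ae ?_
  filter_upwards [hμ.ae_le ae_weight_nonneg] with x hx
  exact mul_nonneg (by positivity) hx

theorem rpow_two_div_le_norm {a : ℝ} (v : E β χ) (ha : 0 ≤ a) (h : a ≤ ‖v‖ ^ ((N : ℝ) / 2)) :
    a ^ (2 / (N : ℝ)) ≤ ‖v‖ := by
  have hN := four_le_cast N
  calc a ^ (2 / (N : ℝ)) ≤ (‖v‖ ^ ((N : ℝ) / 2)) ^ (2 / (N : ℝ)) := by gcongr
    _ = ‖v‖ := by
      rw [← Real.rpow_mul (norm_nonneg v), show (N : ℝ) / 2 * (2 / N) = 1 by field_simp,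
        Real.rpow_one]

theorem fn_norm_le (v : E β χ) : (∫ x, |fn v x| ^ ((N : ℝ) / 2)) ^ (2 / (N : ℝ)) ≤ ‖v‖ := by
  refine rpow_two_div_le_norm v (integral_nonneg fun x => by positivity) ?_
  rw [norm_rpow]
  have h1 := integral_lap_nonneg v volume .rfl
  have h2 : 0 ≤ ∫ x, ‖grad v x‖ ^ ((N : ℝ) / 2) := integral_nonneg fun x => by positivity
  linarith

/-- The weighted `L^{N/2}` norm of `Δv` over the ball `|x|² < T`. -/
noncomputable def lapNorm (v : E β χ) (T : ℝ) : ℝ :=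
  (∫ y in {y : Sp N | ‖y‖ ^ 2 < T}, |lap v y| ^ ((N : ℝ) / 2) * weight β χ y) ^ (2 / (N : ℝ))

theorem lapNorm_nonneg (v : E β χ) (T : ℝ) : 0 ≤ lapNorm v T :=
  Real.rpow_nonneg (integral_lap_nonneg v _ Measure.absolutelyContinuous_restrict) _

theorem integral_lap_le (v : E β χ) :
    ∫ y, |lap v y| ^ ((N : ℝ) / 2) * weight β χ y ≤ ‖v‖ ^ ((N : ℝ) / 2) := by
  rw [norm_rpow]
  have h1 : 0 ≤ ∫ x, |fn v x| ^ ((N : ℝ) / 2) := integral_nonneg fun x => by positivity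
  have h2 : 0 ≤ ∫ x, ‖grad v x‖ ^ ((N : ℝ) / 2) := integral_nonneg fun x => by positivity
  linarith

theorem lapNorm_le (v : E β χ) (T : ℝ) : lapNorm v T ≤ ‖v‖ := by
  refine rpow_two_div_le_norm v
    (integral_lap_nonneg v _ Measure.absolutelyContinuous_restrict) ?_
  refine (setIntegral_le_integral (integrable_abs_lap_rpow_mul v) ?_).trans (integral_lap_le v)
  filter_upwards [ae_weight_nonneg (N := N) (β := β) (χ := χ)] with x hx
  exact mul_nonneg (by positivity) hx

theorem tendsto_lapNorm (v : E β χ) :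
    Tendsto (fun n : ℕ => lapNorm v (1 / ((n : ℝ) + 1))) atTop (𝓝 0) := by
  have := nontrivial_Sp N
  have hN := four_le_cast N
  have h := tendsto_setIntegral_of_antitone (μ := volume)
    (s := fun n : ℕ => {y : Sp N | ‖y‖ ^ 2 < 1 / ((n : ℝ) + 1)})
    (f := fun y => |lap v y| ^ ((N : ℝ) / 2) * weight β χ y)
    (fun n => measurableSet_norm_sq_lt N _)
    (fun m n hmn y hy => show ‖y‖ ^ 2 < 1 / ((m : ℝ) + 1) from
      lt_of_lt_of_le (show ‖y‖ ^ 2 < 1 / ((n : ℝ) + 1) from hy) (Nat.one_div_le_one_div hmn))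
    ⟨0, (integrable_abs_lap_rpow_mul v).integrableOn⟩
  have hz : volume (⋂ n : ℕ, {y : Sp N | ‖y‖ ^ 2 < 1 / ((n : ℝ) + 1)}) = 0 := by
    refine measure_mono_null (fun y hy => ?_) (measure_singleton (0 : Sp N))
    rw [Set.mem_singleton_iff]
    by_contra hy0
    obtain ⟨n, hn⟩ := exists_nat_one_div_lt (K := ℝ) (show 0 < ‖y‖ ^ 2 by positivity)
    exact absurd (Set.mem_iInter.1 hy n) (not_lt.2 hn.le)
  rw [setIntegral_measure_zero _ hz] at h
  have h' := h.rpow_const (p := 2 / (N : ℝ)) (Or.inr (by positivity))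
  rwa [Real.zero_rpow (by positivity)] at h'

theorem fn_sub (v v' : E β χ) : fn (v - v') =ᵐ[volume] fun x => fn v x - fn v' x :=
  Lp.coeFn_sub _ _

/-- The constant in front of the norm in the pointwise estimates. -/
noncomputable def normConst (N : ℕ) : ℝ :=
  4 * (2 / (N * unitBallVolume N) * (1 / 2) ^ (1 - (N : ℝ) / 2)) *
    unitBallVolume N ^ (1 - 2 / (N : ℝ))

theorem normConst_nonneg (N : ℕ) : 0 ≤ normConst N := by
  have := unitBallVolume_pos N
  unfold normConst
  positivity

/-- The T^{N/2−1} from Hölder's inequality cancels the (T/2)^{1−N/2} in `meanConst`, leaving 1/T. -/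
theorem meanConst_mul_le (v : E β χ) {T : ℝ} (hT : 0 < T) :
    meanConst N T * (∫ y in {y : Sp N | ‖y‖ ^ 2 < T}, |fn v y|) ≤ normConst N / T * ‖v‖ := by
  have hV := unitBallVolume_pos N
  have h1 : 0 ≤ meanConst N T := by
    unfold meanConst
    positivity
  have h2 : meanConst N T * (unitBallVolume N ^ (1 - 2 / (N : ℝ)) * T ^ ((N : ℝ) / 2 - 1))
      = normConst N / T := by
    have : (T / 2) ^ (1 - (N : ℝ) / 2) * T ^ ((N : ℝ) / 2 - 1) = (1 / 2) ^ (1 - (N : ℝ) / 2) := by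
      rw [div_eq_mul_one_div, Real.mul_rpow hT.le (by norm_num), mul_right_comm,
        ← Real.rpow_add hT]
      simp
    rw [meanConst, normConst, ← this]
    ring
  calc _ ≤ meanConst N T *
        (unitBallVolume N ^ (1 - 2 / (N : ℝ)) * T ^ ((N : ℝ) / 2 - 1) * ‖v‖) := by
        refine mul_le_mul_of_nonneg_left ((setIntegral_abs_le (aestronglyMeasurable_fn v)
          (integrable_abs_fn_rpow v) hT.le).trans ?_) h1
        exact mul_le_mul_of_nonneg_left (fn_norm_le v) (by positivity)
    _ = _ := by rw [← mul_assoc, h2]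

/-- The constant in front of the logarithm in the pointwise estimate near the origin. -/
noncomputable def logConst (N : ℕ) (β : ℝ) : ℝ :=
  newtonConst N * (N * unitBallVolume N / (1 - β)) ^ (((N : ℝ) - 2) / N)

theorem logConst_nonneg (N : ℕ) [Fact (4 ≤ N)] (hβ1 : β < 1) : 0 ≤ logConst N β := by
  have := unitBallVolume_pos N
  have := newtonConst_pos N
  have : 0 < 1 - β := by linarith
  unfold logConst
  positivity

theorem inv_gammaExp (N : ℕ) (β : ℝ) : 1 / gammaExp N β = (1 - β) * (((N : ℝ) - 2) / N) := by
  rw [gammaExp, one_div_div]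
  ring

/-- The exceptional null set of `ae_abs_le` depends on δ, so only the dyadic values δ = T/2^{n+1}
are used. Choosing n with δ < |x|² ≤ 2δ costs the factor 1/2 inside `logSq`, which is only an
additive constant in the logarithm. -/
theorem ae_abs_fn_le_of_norm_sq_lt (hβ : 0 ≤ β) (hβ1 : β < 1) (v : E β χ) {T : ℝ} (hT : 0 < T)
    (hT1 : T ≤ 1) :
    ∀ᵐ x : Sp N, ‖x‖ ^ 2 < T → |fn v x| ≤ normConst N / T * ‖v‖ +
      logConst N β * lapNorm v T * logSq (‖x‖ ^ 2 / 2) ^ (1 / gammaExp N β) := by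
  have := nontrivial_Sp N
  have hN := four_le_cast N
  have hV0 := unitBallVolume_pos N
  obtain ⟨V, hV⟩ := exists_profile v
  have h : ∀ n : ℕ, ∀ᵐ x : Sp N, ‖x‖ ^ 2 ∈ Set.Ioo (T / 2 * (1 / 2) ^ n) T → |fn v x| ≤
      normConst N / T * ‖v‖ + logConst N β * lapNorm v T *
        logSq (T / 2 * (1 / 2) ^ n) ^ (1 / gammaExp N β) := by
    intro n
    have hδ : 0 < T / 2 * (1 / 2) ^ n := by positivity
    have hδT : T / 2 * (1 / 2) ^ n ≤ T / 2 :=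
      mul_le_of_le_one_right (by positivity) (pow_le_one₀ (by norm_num) (by norm_num))
    filter_upwards [ae_abs_le hV (isWeakLaplacian_lap v) hδ hδT] with x hx hmem
    refine (hx hmem).trans (add_le_add (meanConst_mul_le v hT) ?_)
    have h1 := setIntegral_mul_max_rpow_le χ hβ hβ1 hδ (by linarith) hT1
      (aestronglyMeasurable_lap v) (integrable_abs_lap_rpow_mul v)
    have hL : 0 ≤ logSq (T / 2 * (1 / 2) ^ n) := by
      linarith [one_le_logSq hδ.le (by linarith : T / 2 * (1 / 2) ^ n ≤ 1)]
    have h0 : 0 ≤ N * unitBallVolume N / (1 - β) := div_nonneg (by positivity) (by linarith)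
    rw [Real.mul_rpow h0 (Real.rpow_nonneg hL _), ← Real.rpow_mul hL, ← inv_gammaExp] at h1
    calc _ ≤ newtonConst N * _ := mul_le_mul_of_nonneg_left h1 (newtonConst_pos N).le
      _ = _ := by
        unfold logConst lapNorm
        ring
  filter_upwards [ae_all_iff.2 h, Measure.ae_ne volume (0 : Sp N)] with x hx hx0 hxT
  have hpos : 0 < ‖x‖ ^ 2 := by positivity
  obtain ⟨n, hn1, hn2⟩ := exists_nat_pow_near_of_lt_one (x := ‖x‖ ^ 2 / T) (y := (1 / 2 : ℝ))
    (by positivity) ((div_le_one hT).2 hxT.le) (by norm_num) (by norm_num)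
  rw [lt_div_iff₀ hT] at hn1
  rw [div_le_iff₀ hT] at hn2
  have e : T / 2 * (1 / 2) ^ n = (1 / 2) ^ (n + 1) * T := by ring
  refine (hx n ⟨by rw [e]; exact hn1, hxT⟩).trans ?_
  have hle : ‖x‖ ^ 2 / 2 ≤ T / 2 * (1 / 2) ^ n := by linarith
  have hL : 0 ≤ logSq (T / 2 * (1 / 2) ^ n) := by
    have : T / 2 * (1 / 2) ^ n ≤ 1 := by rw [e]; linarith
    linarith [one_le_logSq (by positivity) this]
  have hg : 0 ≤ 1 / gammaExp N β := by
    rw [inv_gammaExp]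
    exact mul_nonneg (by linarith) (div_nonneg (by linarith) (by linarith))
  refine add_le_add le_rfl (mul_le_mul_of_nonneg_left
    (Real.rpow_le_rpow hL (logSq_anti (by positivity) hle) hg)
    (mul_nonneg (logConst_nonneg N hβ1) (lapNorm_nonneg v T)))

theorem integrable_abs_lap_rpow (hβ : 0 ≤ β) (v : E β χ) :
    Integrable (fun x => |lap v x| ^ ((N : ℝ) / 2)) ∧
      (∫ x, |lap v x| ^ ((N : ℝ) / 2)) ^ (2 / (N : ℝ)) ≤ ‖v‖ := by
  have := nontrivial_Sp N
  have hle : ∀ᵐ x : Sp N, |lap v x| ^ ((N : ℝ) / 2) ≤ |lap v x| ^ ((N : ℝ) / 2) * weight β χ x := by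
    filter_upwards [Measure.ae_ne volume (0 : Sp N)] with x hx
    exact le_mul_of_one_le_right (by positivity) (one_le_weight hβ χ hx)
  have hi : Integrable (fun x => |lap v x| ^ ((N : ℝ) / 2)) := by
    refine (integrable_abs_lap_rpow_mul v).mono'
      ((aestronglyMeasurable_lap v).norm.aemeasurable.pow_const _).aestronglyMeasurable ?_
    filter_upwards [hle] with x hx
    rwa [Real.norm_of_nonneg (by positivity)]
  refine ⟨hi, rpow_two_div_le_norm v (integral_nonneg fun x => by positivity) ?_⟩
  exact (integral_mono_ae hi (integrable_abs_lap_rpow_mul v) hle).trans (integral_lap_le v)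

/-- On the annulus R/4 < |x|² < R, truncation at δ = R/4 makes the kernel at most (R/4)^{1−N/2}, and
Hölder's inequality contributes R^{N/2−1}. The powers of R cancel, so the bound is uniform in R. The
annuli have ratio 4 while R doubles, so the open annuli overlap and cover the exterior. -/
theorem ae_abs_fn_le_of_le_norm_sq (hβ : 0 ≤ β) (v : E β χ) {T : ℝ} (hT : 0 < T) :
    ∀ᵐ x : Sp N, T ≤ ‖x‖ ^ 2 → |fn v x| ≤ (normConst N / T + newtonConst N *
      ((1 / 4) ^ (1 - (N : ℝ) / 2) * unitBallVolume N ^ (1 - 2 / (N : ℝ)))) * ‖v‖ := by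
  have hV0 := unitBallVolume_pos N
  have hc := newtonConst_pos N
  obtain ⟨V, hV⟩ := exists_profile v
  obtain ⟨hi, hle⟩ := integrable_abs_lap_rpow hβ v
  have h : ∀ n : ℕ, ∀ᵐ x : Sp N, ‖x‖ ^ 2 ∈ Set.Ioo (T * 2 ^ (n + 1) / 4) (T * 2 ^ (n + 1)) →
      |fn v x| ≤ (normConst N / T + newtonConst N *
        ((1 / 4) ^ (1 - (N : ℝ) / 2) * unitBallVolume N ^ (1 - 2 / (N : ℝ)))) * ‖v‖ := by
    intro n
    have hTR : T ≤ T * 2 ^ (n + 1) := le_mul_of_one_le_right hT.le (one_le_pow₀ (by norm_num))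
    set R := T * 2 ^ (n + 1)
    have hR : 0 < R := hT.trans_le hTR
    filter_upwards [ae_abs_le hV (isWeakLaplacian_lap v) (show 0 < R / 4 by positivity)
      (by linarith : R / 4 ≤ R / 2)] with x hx hmem
    refine (hx hmem).trans ?_
    rw [add_mul]
    refine add_le_add ((meanConst_mul_le v hR).trans ?_) ?_
    · have := normConst_nonneg N
      gcongr
    · rw [mul_assoc]
      refine mul_le_mul_of_nonneg_left ?_ hc.le
      have hloc := (isWeakLaplacian_lap v).2.1
      calc _ ≤ ∫ y in {y : Sp N | ‖y‖ ^ 2 < R}, |lap v y| * (R / 4) ^ (1 - (N : ℝ) / 2) :=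
            integral_mono (integrableOn_mul_max_rpow (by positivity) hloc R)
              ((integrableOn_norm_sq_lt hloc R).abs.mul_const _) fun y =>
              mul_le_mul_of_nonneg_left (max_rpow_le (by positivity) _) (abs_nonneg _)
        _ = (R / 4) ^ (1 - (N : ℝ) / 2) * ∫ y in {y : Sp N | ‖y‖ ^ 2 < R}, |lap v y| := by
            rw [integral_mul_const, mul_comm]
        _ ≤ (R / 4) ^ (1 - (N : ℝ) / 2) * (unitBallVolume N ^ (1 - 2 / (N : ℝ)) *
              R ^ ((N : ℝ) / 2 - 1) * ‖v‖) := by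
            refine mul_le_mul_of_nonneg_left ((setIntegral_abs_le (aestronglyMeasurable_lap v)
              hi hR.le).trans ?_) (by positivity)
            exact mul_le_mul_of_nonneg_left hle (by positivity)
        _ = _ := by
            have : (R / 4) ^ (1 - (N : ℝ) / 2) * R ^ ((N : ℝ) / 2 - 1)
                = (1 / 4) ^ (1 - (N : ℝ) / 2) := by
              rw [div_eq_mul_one_div, Real.mul_rpow hR.le (by norm_num), mul_right_comm,
                ← Real.rpow_add hR]
              simp
            rw [← this]
            ring
  filter_upwards [ae_all_iff.2 h] with x hx hxT
  obtain ⟨n, hn1, hn2⟩ := exists_nat_pow_near (x := ‖x‖ ^ 2 / T) (y := (2 : ℝ))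
    ((one_le_div hT).2 hxT) (by norm_num)
  rw [le_div_iff₀ hT] at hn1
  rw [div_lt_iff₀ hT] at hn2
  refine hx n ⟨?_, by rwa [mul_comm]⟩
  have : 0 < 2 ^ n * T := by positivity
  rw [pow_succ]
  linarith

end SpaceE
-- The norm of the difference, by Brezis–Lieb.
section BrezisLieb

/-- Choose d with (1+d)^q = 1+ε. If y ≤ dx the first term alone suffices, and otherwise x ≤ y/d and
the second does. -/
theorem exists_add_rpow_le {q ε : ℝ} (hq : 0 < q) (hε : 0 < ε) :
    ∃ C : ℝ, 0 ≤ C ∧ ∀ x y : ℝ, 0 ≤ x → 0 ≤ y → (x + y) ^ q ≤ (1 + ε) * x ^ q + C * y ^ q := by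
  set d := (1 + ε) ^ (1 / q) - 1 with hd
  have hd0 : 0 < d := sub_pos.2 (Real.one_lt_rpow (by linarith) (by positivity))
  have hdq : (1 + d) ^ q = 1 + ε := by
    rw [hd, add_sub_cancel, ← Real.rpow_mul (by linarith), one_div_mul_cancel hq.ne', Real.rpow_one]
  refine ⟨(1 + 1 / d) ^ q, by positivity, fun x y hx hy => ?_⟩
  have hxq : 0 ≤ x ^ q := by positivity
  have hyq : 0 ≤ y ^ q := by positivity
  rcases le_total y (d * x) with h | h
  · calc (x + y) ^ q ≤ ((1 + d) * x) ^ q := by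
          gcongr
          linarith
      _ = (1 + ε) * x ^ q := by rw [Real.mul_rpow (by positivity) hx, hdq]
      _ ≤ _ := le_add_of_nonneg_right (by positivity)
  · have hx' : x ≤ 1 / d * y := by
      rw [one_div_mul_eq_div, le_div_iff₀ hd0]
      linarith
    calc (x + y) ^ q ≤ ((1 + 1 / d) * y) ^ q := by
          gcongr
          linarith
      _ = (1 + 1 / d) ^ q * y ^ q := Real.mul_rpow (by positivity) hy
      _ ≤ _ := le_add_of_nonneg_left (by positivity)

/-- One half of the Brezis–Lieb lemma. -/
theorem eventually_integral_norm_sub_rpow_le {X F : Type*} [MeasurableSpace X]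
    [NormedAddCommGroup F] {μ : Measure X} {q : ℝ} (hq : 0 < q) {f : ℕ → X → F} {g : X → F}
    (hf : ∀ k, Integrable (fun x => ‖f k x‖ ^ q) μ) (hg : Integrable (fun x => ‖g x‖ ^ q) μ)
    (hfg : ∀ k, Integrable (fun x => ‖f k x - g x‖ ^ q) μ)
    (hlim : ∀ᵐ x ∂μ, Tendsto (fun k => f k x) atTop (𝓝 (g x))) {ε : ℝ} (hε : 0 < ε) :
    ∀ᶠ k in atTop, ∫ x, ‖f k x - g x‖ ^ q ∂μ + ∫ x, ‖g x‖ ^ q ∂μ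
      ≤ (1 + ε) * ∫ x, ‖f k x‖ ^ q ∂μ + ε := by
  obtain ⟨C, hC, hCle⟩ := exists_add_rpow_le hq hε
  -- D is bounded above by (C+1)‖g‖^q and tends pointwise to −ε‖g‖^q ≤ 0. Its positive part is
  -- therefore dominated and has integral tending to 0.
  set D : ℕ → X → ℝ := fun k x => ‖f k x - g x‖ ^ q + ‖g x‖ ^ q - (1 + ε) * ‖f k x‖ ^ q with hD
  have hDi : ∀ k, Integrable (D k) μ := fun k => ((hfg k).add hg).sub ((hf k).const_mul _)
  have hDle : ∀ k x, D k x ≤ (C + 1) * ‖g x‖ ^ q := fun k x => by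
    have h1 : ‖f k x - g x‖ ^ q ≤ (‖f k x‖ + ‖g x‖) ^ q := by
      gcongr
      exact norm_sub_le _ _
    have h2 := hCle _ _ (norm_nonneg (f k x)) (norm_nonneg (g x))
    simp only [hD]
    linarith
  have hlim0 : Tendsto (fun k => ∫ x, max (D k x) 0 ∂μ) atTop (𝓝 0) := by
    suffices h : Tendsto (fun k => ∫ x, max (D k x) 0 ∂μ) atTop (𝓝 (∫ _, (0 : ℝ) ∂μ)) by
      rwa [integral_zero] at h
    refine tendsto_integral_of_dominated_convergence (fun x => (C + 1) * ‖g x‖ ^ q)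
      (fun k => (hDi k).pos_part.aestronglyMeasurable) (hg.const_mul _) (fun k => ?_) ?_
    · refine ae_of_all _ fun x => ?_
      rw [Real.norm_of_nonneg (le_max_right _ _)]
      exact max_le (hDle k x) (by positivity)
    · filter_upwards [hlim] with x hx
      have h1 : Tendsto (fun k => D k x) atTop
          (𝓝 (‖g x - g x‖ ^ q + ‖g x‖ ^ q - (1 + ε) * ‖g x‖ ^ q)) :=
        (((hx.sub_const (g x)).norm.rpow_const (Or.inr hq.le)).add_const _).sub
          ((hx.norm.rpow_const (Or.inr hq.le)).const_mul _)
      have h2 := h1.max (tendsto_const_nhds (x := (0 : ℝ)))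
      rw [sub_self, norm_zero, Real.zero_rpow hq.ne', max_eq_right] at h2
      · exact h2
      · have : 0 ≤ ‖g x‖ ^ q := by positivity
        nlinarith
  filter_upwards [hlim0.eventually_le_const hε] with k hk
  have h1 : ∫ x, D k x ∂μ ≤ ε :=
    (integral_mono (hDi k) (hDi k).pos_part fun x => le_max_left _ _).trans hk
  have h2 : ∫ x, D k x ∂μ = ∫ x, ‖f k x - g x‖ ^ q ∂μ + ∫ x, ‖g x‖ ^ q ∂μ
      - (1 + ε) * ∫ x, ‖f k x‖ ^ q ∂μ := by
    rw [← integral_const_mul, ← integral_add (hfg k) hg]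
    exact integral_sub ((hfg k).add hg) ((hf k).const_mul _)
  linarith

theorem weightMeasure_absolutelyContinuous {N : ℕ} {β : ℝ} {χ : WeightProfile N} :
    weightMeasure β χ ≪ volume :=
  withDensity_absolutelyContinuous _ _

variable {N : ℕ} [Fact (4 ≤ N)] {β : ℝ} {χ : WeightProfile N}

theorem eventually_Lp_norm_sub_rpow_le {F : Type*} [NormedAddCommGroup F] {μ : Measure (Sp N)}
    {f : ℕ → Lp F (halfDim N) μ} {g : Lp F (halfDim N) μ}
    (hlim : ∀ᵐ x ∂μ, Tendsto (fun k => f k x) atTop (𝓝 (g x))) {ε : ℝ} (hε : 0 < ε) :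
    ∀ᶠ k in atTop, ‖f k - g‖ ^ ((N : ℝ) / 2) + ‖g‖ ^ ((N : ℝ) / 2)
      ≤ (1 + ε) * ‖f k‖ ^ ((N : ℝ) / 2) + ε := by
  have hN := four_le_cast N
  have he : ∀ k, (fun x => ‖(f k - g : Lp F (halfDim N) μ) x‖ ^ ((N : ℝ) / 2)) =ᵐ[μ]
      fun x => ‖f k x - g x‖ ^ ((N : ℝ) / 2) := fun k => by
    filter_upwards [Lp.coeFn_sub (f k) g] with x hx
    rw [hx, Pi.sub_apply]
  have := eventually_integral_norm_sub_rpow_le (q := (N : ℝ) / 2) (by linarith)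
    (fun k => Lp_integrable_rpow (f k)) (Lp_integrable_rpow g)
    (fun k => (Lp_integrable_rpow (f k - g)).congr (he k)) hlim hε
  filter_upwards [this] with k hk
  rw [Lp_norm_rpow, Lp_norm_rpow, Lp_norm_rpow, integral_congr_ae (he k)]
  exact hk

/-- The N/2-th power of the norm is the sum over the three components, each contributing its own
additive error ε. -/
theorem eventually_norm_sub_rpow_le {u : ℕ → E β χ} {u₀ : E β χ}
    (hfn : ∀ᵐ x, Tendsto (fun k => fn (u k) x) atTop (𝓝 (fn u₀ x)))
    (hgrad : ∀ᵐ x, Tendsto (fun k => grad (u k) x) atTop (𝓝 (grad u₀ x)))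
    (hlap : ∀ᵐ x, Tendsto (fun k => lap (u k) x) atTop (𝓝 (lap u₀ x))) {ε : ℝ} (hε : 0 < ε) :
    ∀ᶠ k in atTop, ‖u k - u₀‖ ^ ((N : ℝ) / 2) + ‖u₀‖ ^ ((N : ℝ) / 2)
      ≤ (1 + ε) * ‖u k‖ ^ ((N : ℝ) / 2) + 3 * ε := by
  have hT : ∀ v : E β χ, ‖v‖ ^ ((N : ℝ) / 2) = ‖(v : Triples β χ).fst‖ ^ ((N : ℝ) / 2) +
      (‖(v : Triples β χ).snd.fst‖ ^ ((N : ℝ) / 2) +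
        ‖(v : Triples β χ).snd.snd‖ ^ ((N : ℝ) / 2)) := fun v => by
    rw [show ‖v‖ = ‖(v : Triples β χ)‖ from rfl, prod_norm_rpow, prod_norm_rpow]
  filter_upwards [eventually_Lp_norm_sub_rpow_le (f := fun k => (u k : Triples β χ).fst)
      (g := (u₀ : Triples β χ).fst) hfn hε,
    eventually_Lp_norm_sub_rpow_le (f := fun k => (u k : Triples β χ).snd.fst)
      (g := (u₀ : Triples β χ).snd.fst) hgrad hε,
    eventually_Lp_norm_sub_rpow_le (f := fun k => (u k : Triples β χ).snd.snd)
      (g := (u₀ : Triples β χ).snd.snd) (weightMeasure_absolutelyContinuous.ae_le hlap) hε]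
    with k h1 h2 h3
  have e1 : ((u k - u₀ : E β χ) : Triples β χ).fst = (u k : Triples β χ).fst -
    (u₀ : Triples β χ).fst := rfl
  have e2 : ((u k - u₀ : E β χ) : Triples β χ).snd.fst = (u k : Triples β χ).snd.fst -
    (u₀ : Triples β χ).snd.fst := rfl
  have e3 : ((u k - u₀ : E β χ) : Triples β χ).snd.snd = (u k : Triples β χ).snd.snd -
    (u₀ : Triples β χ).snd.snd := rfl
  rw [hT, hT u₀, hT (u k), e1, e2, e3]
  linarith

end BrezisLieb

/-! ### Arithmetic of β, γ and α_β. -/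

section Exponents

variable {N : ℕ} [Fact (4 ≤ N)] {β : ℝ}

theorem beta_nonneg (hβ : ((N : ℝ) ^ 2 - 4 * N + 2) / (N * ((N : ℝ) - 2)) < β) : 0 ≤ β := by
  have hN := four_le_cast N
  refine le_trans (div_nonneg ?_ (mul_nonneg (by linarith) (by linarith))) hβ.le
  nlinarith

/-- The lower bound on β gives (N−2)(1−β) < 2 − 2/N. -/
theorem half_le_gammaExp (hβ : ((N : ℝ) ^ 2 - 4 * N + 2) / (N * ((N : ℝ) - 2)) < β)
    (hβ1 : β < 1) : (N : ℝ) / 2 ≤ gammaExp N β := by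
  have hN := four_le_cast N
  have h2 : 0 < (N : ℝ) - 2 := by linarith
  rw [div_lt_iff₀ (by positivity)] at hβ
  have h1 : 0 < 1 - β := by linarith
  refine div_le_div_of_nonneg_left (by positivity) (by positivity) ?_
  nlinarith

/-- The powers of N·V_N and of 1−β cancel exactly. What remains beside N is (N−2)^{−1/(1−β)}, at
most 1 since N ≥ 4. -/
theorem alphaBeta_mul_logConst_rpow_le (hβ1 : β < 1) :
    alphaBeta N β * logConst N β ^ gammaExp N β ≤ N := by
  have hN := four_le_cast N
  have hV := unitBallVolume_pos N
  have hm : 0 < (N : ℝ) - 2 := by linarith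
  have hb : 0 < 1 - β := by linarith
  set m : ℝ := (N : ℝ) - 2 with hmdef
  set Q : ℝ := N * unitBallVolume N with hQdef
  have hQ : 0 < Q := by positivity
  set b : ℝ := 1 - β with hbdef
  have hmN : (N : ℝ) = m + 2 := by rw [hmdef]; ring
  have eg : gammaExp N β = N / (m * b) := rfl
  have e1 : m / N * (N / (m * b)) = 1 / b := by field_simp
  have hlog : logConst N β ^ gammaExp N β
      = m ^ (-(N / (m * b))) * Q ^ (-(N / (m * b))) * (Q ^ (1 / b) * b ^ (-(1 / b))) := by
    rw [logConst, newtonConst, ← hmdef, ← hQdef, eg,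
      Real.mul_rpow (by positivity) (by positivity), ← Real.rpow_mul (by positivity), e1, one_div,
      Real.inv_rpow (by positivity), ← Real.rpow_neg (by positivity),
      Real.mul_rpow hm.le hQ.le, Real.div_rpow hQ.le hb.le, Real.rpow_neg hb.le, ← div_eq_mul_inv]
  have halpha : alphaBeta N β = N * (m ^ (2 / (m * b)) * Q ^ (2 / (m * b))) * b ^ (1 / b) := by
    rw [alphaBeta, ← hmdef, mul_assoc m, ← hQdef, Real.mul_rpow hm.le hQ.le]
  have eQ : Q ^ (2 / (m * b)) * Q ^ (-(N / (m * b))) * Q ^ (1 / b) = 1 := by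
    rw [← Real.rpow_add hQ, ← Real.rpow_add hQ, hmN]
    have : 2 / (m * b) + -((m + 2) / (m * b)) + 1 / b = 0 := by field_simp; ring
    rw [this, Real.rpow_zero]
  have eb : b ^ (1 / b) * b ^ (-(1 / b)) = 1 := by
    rw [← Real.rpow_add hb]
    simp
  have em : m ^ (2 / (m * b)) * m ^ (-(N / (m * b))) ≤ 1 := by
    rw [← Real.rpow_add hm]
    refine Real.rpow_le_one_of_one_le_of_nonpos (by linarith) ?_
    rw [← sub_eq_add_neg, ← sub_div]
    exact div_nonpos_of_nonpos_of_nonneg (by linarith) (by positivity)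
  rw [hlog, halpha]
  calc _ = N * (m ^ (2 / (m * b)) * m ^ (-(N / (m * b)))) *
        (Q ^ (2 / (m * b)) * Q ^ (-(N / (m * b))) * Q ^ (1 / b)) *
        (b ^ (1 / b) * b ^ (-(1 / b))) := by ring
    _ ≤ N * 1 * 1 * 1 := by rw [eQ, eb]; gcongr
    _ = N := by ring

theorem alphaBeta_nonneg (hβ1 : β < 1) : 0 ≤ alphaBeta N β := by
  have hN := four_le_cast N
  have := unitBallVolume_pos N
  have : 0 < (N : ℝ) - 2 := by linarith
  have : 0 < 1 - β := by linarith
  unfold alphaBeta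
  positivity

end Exponents

/-! ### Uniform exponential integrability from pointwise bounds. -/

section Integrability

variable {N : ℕ} [Fact (4 ≤ N)] {β : ℝ} {χ : WeightProfile N}

theorem exp_logSq {a t : ℝ} (ht : 0 < t) :
    Real.exp (a * logSq (t / 2)) = Real.exp (a * (1 + Real.log 2 / 2)) * t ^ (-(a / 2)) := by
  rw [Real.rpow_def_of_pos ht, ← Real.exp_add, logSq, Real.log_div ht.ne' two_ne_zero]
  congr 1
  ring

theorem exp_sub_one_le {z Z : ℝ} (h0 : 0 ≤ z) (h : z ≤ Z) :
    Real.exp z - 1 ≤ z * Real.exp Z := by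
  have h1 := Real.add_one_le_exp (-z)
  have h2 := mul_le_mul_of_nonneg_left h1 (Real.exp_pos z).le
  rw [← Real.exp_add, add_neg_cancel, Real.exp_zero] at h2
  have h3 : z * Real.exp z ≤ z * Real.exp Z :=
    mul_le_mul_of_nonneg_left (Real.exp_le_exp.2 h) h0
  linarith

/-- Inside, the exponential is dominated by a multiple of |x|^{−κN}, integrable because κ < 1.
Outside, boundedness and g ≥ N/2 dominate the integrand by a multiple of |u_k|^{N/2}, whose integral
the norm controls. -/
theorem iSup_lintegral_exp_lt_top {u : ℕ → E β χ} {s g T A B D κ : ℝ} (hs : 0 ≤ s)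
    (hg : (N : ℝ) / 2 ≤ g) (hκ : κ < 1) (hu : ∀ k, ‖u k‖ ≤ B)
    (hin : ∀ k, ∀ᵐ x : Sp N, ‖x‖ ^ 2 < T →
      s * |fn (u k) x| ^ g ≤ κ * N * logSq (‖x‖ ^ 2 / 2) + D)
    (hout : ∀ k, ∀ᵐ x : Sp N, T ≤ ‖x‖ ^ 2 → |fn (u k) x| ≤ A) :
    (⨆ k, ∫⁻ x, ENNReal.ofReal (Real.exp (s * |fn (u k) x| ^ g) - 1)) < ⊤ := by
  have := nontrivial_Sp N
  have hN := four_le_cast N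
  set S := {x : Sp N | ‖x‖ ^ 2 < T} with hS
  have hSm : MeasurableSet S := measurableSet_norm_sq_lt N T
  set K : ℝ := Real.exp D * Real.exp (κ * N * (1 + Real.log 2 / 2)) with hK
  set F : Sp N → ℝ := S.indicator fun x => K * (‖x‖ ^ 2) ^ (-(κ * N / 2)) with hF
  have hF0 : ∀ x, 0 ≤ F x := fun x => Set.indicator_nonneg (fun y _ => by positivity) _
  have hFi : Integrable F := by
    refine (integrable_indicator_iff hSm).2 (Integrable.const_mul ?_ K)
    refine (integrableOn_comp_norm_sq (F := fun t => t ^ (-(κ * N / 2)))).2 ?_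
    rcases le_or_gt T 0 with hT | hT
    · rw [Set.Ioo_eq_empty (not_lt.2 hT)]
      exact integrableOn_empty
    have h1 : IntegrableOn (fun t : ℝ => t ^ ((N : ℝ) / 2 - 1 + -(κ * N / 2))) (Set.Ioo 0 T) :=
      (intervalIntegral.integrableOn_Ioo_rpow_iff hT).2 (by nlinarith)
    exact h1.congr_fun (fun t ht => Real.rpow_add ht.1 _ _) measurableSet_Ioo
  -- From e^z − 1 ≤ z e^Z for 0 ≤ z ≤ Z, splitting off |A|^{g−N/2} from the g-th power.
  set C : ℝ := s * |A| ^ (g - (N : ℝ) / 2) * Real.exp (s * |A| ^ g) with hC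
  have hC0 : 0 ≤ C := by positivity
  set G : ℕ → Sp N → ℝ := fun k x => F x + C * |fn (u k) x| ^ ((N : ℝ) / 2) with hG
  have hGi : ∀ k, Integrable (G k) := fun k =>
    hFi.add ((integrable_abs_fn_rpow (u k)).const_mul C)
  have hGle : ∀ k, ∫ x, G k x ≤ (∫ x, F x) + C * B ^ ((N : ℝ) / 2) := fun k => by
    simp only [hG]
    rw [integral_add hFi ((integrable_abs_fn_rpow (u k)).const_mul C), integral_const_mul]
    gcongr
    have h1 : ∫ x, |fn (u k) x| ^ ((N : ℝ) / 2) ≤ ‖u k‖ ^ ((N : ℝ) / 2) := by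
      rw [norm_rpow]
      have h1 := integral_lap_nonneg (u k) volume .rfl
      have h2 : 0 ≤ ∫ x, ‖grad (u k) x‖ ^ ((N : ℝ) / 2) := integral_nonneg fun x => by positivity
      linarith
    refine h1.trans ?_
    gcongr
    exact hu k
  refine lt_of_le_of_lt (iSup_le fun k => ?_)
    (ENNReal.ofReal_lt_top (r := (∫ x, F x) + C * B ^ ((N : ℝ) / 2)))
  refine le_trans ?_ (ENNReal.ofReal_le_ofReal (hGle k))
  rw [ofReal_integral_eq_lintegral_ofReal (hGi k)
    (ae_of_all _ fun x => add_nonneg (hF0 x) (by positivity))]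
  refine lintegral_mono_ae ?_
  filter_upwards [hin k, hout k, Measure.ae_ne volume (0 : Sp N)] with x h1 h2 hx0
  refine ENNReal.ofReal_le_ofReal ?_
  have hpos : 0 < ‖x‖ ^ 2 := by positivity
  by_cases hx : x ∈ S
  · have h3 := Real.exp_le_exp.2 (h1 hx)
    rw [Real.exp_add, exp_logSq hpos] at h3
    have h4 : F x = K * (‖x‖ ^ 2) ^ (-(κ * N / 2)) := Set.indicator_of_mem hx _
    have h5 : 0 ≤ C * |fn (u k) x| ^ ((N : ℝ) / 2) := by positivity
    simp only [hG]
    rw [h4, hK]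
    linarith
  · have h3 : |fn (u k) x| ≤ |A| := (h2 (not_lt.1 hx)).trans (le_abs_self A)
    have h4 : s * |fn (u k) x| ^ g ≤ s * |A| ^ g := by
      gcongr
      linarith
    refine (exp_sub_one_le (by positivity) h4).trans ?_
    have h5 : |fn (u k) x| ^ g ≤ |A| ^ (g - (N : ℝ) / 2) * |fn (u k) x| ^ ((N : ℝ) / 2) := by
      rw [show |fn (u k) x| ^ g = |fn (u k) x| ^ (g - (N : ℝ) / 2) * |fn (u k) x| ^ ((N : ℝ) / 2) by
        rw [← Real.rpow_add_of_nonneg (abs_nonneg _) (by linarith) (by linarith), sub_add_cancel]]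
      gcongr
    calc _ ≤ s * (|A| ^ (g - (N : ℝ) / 2) * |fn (u k) x| ^ ((N : ℝ) / 2)) *
          Real.exp (s * |A| ^ g) := by gcongr
      _ = C * |fn (u k) x| ^ ((N : ℝ) / 2) := by rw [hC]; ring
      _ ≤ G k x := le_add_of_nonneg_left (hF0 x)

end Integrability
-- The threshold U and the splitting u_k = u₀ + (u_k − u₀).
section Threshold

variable {N : ℕ} [Fact (4 ≤ N)] {β : ℝ} {χ : WeightProfile N}

theorem gammaExp_pos (hβ1 : β < 1) : 0 < gammaExp N β := by
  have hN := four_le_cast N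
  have h1 : 0 < (N : ℝ) - 2 := by linarith
  have h2 : 0 < 1 - β := by linarith
  unfold gammaExp
  positivity

/-- The truncation `max 0` treats both branches of the threshold at once: for t ≥ 1 the base is 0
and every p is allowed. -/
theorem mul_rpow_lt_one_of_lt_threshold (hβ1 : β < 1) {p t : ℝ} (ht : 0 ≤ t)
    (hp : (p : EReal) < threshold N β t) :
    p * ((max 0 (1 - t ^ ((N : ℝ) / 2))) ^ (2 / (N : ℝ))) ^ gammaExp N β < 1 := by
  have hN := four_le_cast N
  have hγ : 0 < gammaExp N β := gammaExp_pos hβ1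
  rcases lt_or_ge t 1 with h | h
  · have hX : 0 < 1 - t ^ ((N : ℝ) / 2) := sub_pos.2 (Real.rpow_lt_one ht h (by linarith))
    rw [threshold, if_pos h, EReal.coe_lt_coe_iff, lt_div_iff₀ (by positivity)] at hp
    rw [max_eq_right hX.le, ← Real.rpow_mul hX.le,
      show 2 / (N : ℝ) * gammaExp N β = 2 * gammaExp N β / N by ring]
    exact hp
  · have hX : 1 - t ^ ((N : ℝ) / 2) ≤ 0 :=
      sub_nonpos.2 (Real.one_le_rpow h (by linarith))
    rw [max_eq_left hX, Real.zero_rpow (by positivity), Real.zero_rpow hγ.ne', mul_zero]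
    exact one_pos

theorem exists_gt_mul_rpow_lt_one {p s₀ g : ℝ} (hg : 0 < g) (h : p * s₀ ^ g < 1) :
    ∃ s, s₀ < s ∧ ∃ ε, 0 < ε ∧ p * (1 + ε) * s ^ g < 1 := by
  have h1 : Tendsto (fun s : ℝ => p * s ^ g) (𝓝[>] s₀) (𝓝 (p * s₀ ^ g)) :=
    ((Real.continuous_rpow_const hg.le).const_mul p).continuousWithinAt
  obtain ⟨s, hs1, hs2⟩ := ((h1.eventually_lt_const h).and self_mem_nhdsWithin).exists
  have h2 : Tendsto (fun ε : ℝ => p * (1 + ε) * s ^ g) (𝓝[>] 0) (𝓝 (p * (1 + 0) * s ^ g)) :=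
    Continuous.continuousWithinAt (by fun_prop)
  rw [add_zero, mul_one] at h2
  obtain ⟨ε, hε1, hε2⟩ := ((h2.eventually_lt_const hs1).and self_mem_nhdsWithin).exists
  exact ⟨s, hs2, ε, hε2, hε1⟩

theorem eventually_norm_sub_le {u : ℕ → E β χ} {u₀ : E β χ} (hnorm : ∀ k, ‖u k‖ = 1)
    (hfn : ∀ᵐ x, Tendsto (fun k => fn (u k) x) atTop (𝓝 (fn u₀ x)))
    (hgrad : ∀ᵐ x, Tendsto (fun k => grad (u k) x) atTop (𝓝 (grad u₀ x)))
    (hlap : ∀ᵐ x, Tendsto (fun k => lap (u k) x) atTop (𝓝 (lap u₀ x))) {τ : ℝ}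
    (hτ : (max 0 (1 - ‖u₀‖ ^ ((N : ℝ) / 2))) ^ (2 / (N : ℝ)) < τ) :
    ∀ᶠ k in atTop, ‖u k - u₀‖ ≤ τ := by
  have hN := four_le_cast N
  set X := max 0 (1 - ‖u₀‖ ^ ((N : ℝ) / 2)) with hX
  have hX0 : 0 ≤ X := le_max_left _ _
  have hτ0 : 0 ≤ τ := (Real.rpow_nonneg hX0 _).trans hτ.le
  have hlt : X < τ ^ ((N : ℝ) / 2) := by
    have := Real.rpow_lt_rpow (Real.rpow_nonneg hX0 _) hτ (show 0 < (N : ℝ) / 2 by linarith)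
    rwa [← Real.rpow_mul hX0, show 2 / (N : ℝ) * (N / 2) = 1 by field_simp, Real.rpow_one] at this
  -- With ‖u k‖ = 1 the total error is ε + 3ε, hence the quarter of the gap.
  filter_upwards [eventually_norm_sub_rpow_le hfn hgrad hlap
    (show 0 < (τ ^ ((N : ℝ) / 2) - X) / 4 by linarith)] with k hk
  rw [hnorm k, Real.one_rpow] at hk
  have h1 : 1 - ‖u₀‖ ^ ((N : ℝ) / 2) ≤ X := le_max_right _ _
  exact (Real.rpow_le_rpow_iff (norm_nonneg _) hτ0 (show 0 < (N : ℝ) / 2 by linarith)).1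
    (by linarith)

theorem exists_lapNorm_le {u : ℕ → E β χ} {u₀ : E β χ} (k₀ : ℕ) {d : ℝ} (hd : 0 < d) :
    ∃ T, 0 < T ∧ T ≤ 1 ∧ lapNorm u₀ T ≤ d ∧ ∀ k < k₀, lapNorm (u k) T ≤ d := by
  have h1 : ∀ᶠ n : ℕ in atTop, ∀ k ∈ Finset.range k₀, lapNorm (u k) (1 / ((n : ℝ) + 1)) ≤ d :=
    (Filter.eventually_all_finset _).2 fun k _ => (tendsto_lapNorm (u k)).eventually_le_const hd
  obtain ⟨n, hn1, hn2⟩ := (((tendsto_lapNorm u₀).eventually_le_const hd).and h1).exists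
  refine ⟨1 / ((n : ℝ) + 1), by positivity, ?_, hn1, fun k hk => hn2 k (Finset.mem_range.2 hk)⟩
  rw [div_le_one (by positivity)]
  linarith [n.cast_nonneg (α := ℝ)]

/-- If `u k` is eventually close to `u₀`, then all `u k` obey near the origin a logarithmic bound
governed by the distance to `u₀` alone. -/
theorem exists_uniform_log_bound (hβ : 0 ≤ β) (hβ1 : β < 1) {u : ℕ → E β χ} {u₀ : E β χ}
    (hnorm : ∀ k, ‖u k‖ = 1) {τ d : ℝ} (hτ : 0 ≤ τ) (hd : 0 < d)
    (hclose : ∀ᶠ k in atTop, ‖u k - u₀‖ ≤ τ) :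
    ∃ T C, 0 < T ∧ T ≤ 1 ∧ 0 ≤ C ∧ ∀ k, ∀ᵐ x : Sp N, ‖x‖ ^ 2 < T → |fn (u k) x| ≤
      logConst N β * (τ + d) * logSq (‖x‖ ^ 2 / 2) ^ (1 / gammaExp N β) + C := by
  obtain ⟨k₀, hk₀⟩ := eventually_atTop.1 hclose
  obtain ⟨T, hT, hT1, h0, hfin⟩ := exists_lapNorm_le (u := u) (u₀ := u₀) k₀ hd
  have hc := logConst_nonneg N hβ1
  have hA : 0 ≤ normConst N / T := div_nonneg (normConst_nonneg N) hT.le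
  have hL : ∀ x : Sp N, ‖x‖ ^ 2 < T → 0 ≤ logSq (‖x‖ ^ 2 / 2) ^ (1 / gammaExp N β) :=
    fun x hx => Real.rpow_nonneg
      (zero_le_one.trans (one_le_logSq (by positivity) (by linarith))) _
  -- 2‖u₀‖ + 1 bounds ‖u₀‖ + ‖u_k − u₀‖, since ‖u k‖ = 1.
  refine ⟨T, normConst N / T * (2 * ‖u₀‖ + 1), hT, hT1, by positivity, fun k => ?_⟩
  -- The finitely many early k are estimated directly, their local norms being at most d. For later
  -- k, d pays for `u₀` and τ for the difference.
  rcases lt_or_ge k k₀ with hk | hk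
  · filter_upwards [ae_abs_fn_le_of_norm_sq_lt hβ hβ1 (u k) hT hT1] with x hx hxT
    have hLx := hL x hxT
    rw [hnorm k] at hx
    have h1 : logConst N β * lapNorm (u k) T ≤ logConst N β * (τ + d) :=
      mul_le_mul_of_nonneg_left (by linarith [hfin k hk]) hc
    have h2 := mul_le_mul_of_nonneg_right h1 hLx
    have h3 : normConst N / T * 1 ≤ normConst N / T * (2 * ‖u₀‖ + 1) :=
      mul_le_mul_of_nonneg_left (by linarith [norm_nonneg u₀]) hA
    linarith [hx hxT]
  · filter_upwards [ae_abs_fn_le_of_norm_sq_lt hβ hβ1 u₀ hT hT1,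
      ae_abs_fn_le_of_norm_sq_lt hβ hβ1 (u k - u₀) hT hT1, fn_sub (u k) u₀] with x hx hx' he hxT
    have hLx := hL x hxT
    have htri : |fn (u k) x| ≤ |fn u₀ x| + |fn (u k - u₀) x| := by
      rw [he]
      have := abs_add_le (fn u₀ x) (fn (u k) x - fn u₀ x)
      rwa [add_sub_cancel] at this
    have h1 : logConst N β * (lapNorm u₀ T + lapNorm (u k - u₀) T) ≤ logConst N β * (τ + d) :=
      mul_le_mul_of_nonneg_left (by linarith [lapNorm_le (u k - u₀) T, hk₀ k hk]) hc
    have h2 := mul_le_mul_of_nonneg_right h1 hLx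
    have h3 : normConst N / T * (‖u₀‖ + ‖u k - u₀‖) ≤ normConst N / T * (2 * ‖u₀‖ + 1) :=
      mul_le_mul_of_nonneg_left (by linarith [norm_sub_le (u k) u₀, hnorm k]) hA
    linarith [hx hxT, hx' hxT]

end Threshold
end LogAdams

theorem lemma5p1 (N : ℕ) [Fact (4 ≤ N)] (β : ℝ)
    (hβ : ((N : ℝ) ^ 2 - 4 * N + 2) / (N * ((N : ℝ) - 2)) < β) (hβ1 : β < 1)
    (χ : LogAdams.WeightProfile N)
    (u : ℕ → LogAdams.E β χ) (u₀ : LogAdams.E β χ)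
    (hnorm : ∀ k, ‖u k‖ = 1)
    (hweak : ∀ ℓ : LogAdams.E β χ →L[ℝ] ℝ, Tendsto (fun k => ℓ (u k)) atTop (𝓝 (ℓ u₀)))
    (hfn : ∀ᵐ x, Tendsto (fun k => LogAdams.fn (u k) x) atTop (𝓝 (LogAdams.fn u₀ x)))
    (hgrad : ∀ᵐ x, Tendsto (fun k => LogAdams.grad (u k) x) atTop (𝓝 (LogAdams.grad u₀ x)))
    (hlap : ∀ᵐ x, Tendsto (fun k => LogAdams.lap (u k) x) atTop (𝓝 (LogAdams.lap u₀ x)))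
    (hne : u₀ ≠ 0) (p : ℝ) (hp : 1 < p) (hpU : (p : EReal) < LogAdams.threshold N β ‖u₀‖) :
    (⨆ k, ∫⁻ x, ENNReal.ofReal
        (Real.exp (p * LogAdams.alphaBeta N β * |LogAdams.fn (u k) x| ^ LogAdams.gammaExp N β) - 1))
      < ⊤ := by
  open LogAdams in
  have hβ0 : 0 ≤ β := beta_nonneg hβ
  have hγ : 0 < gammaExp N β := gammaExp_pos hβ1
  have hα : 0 ≤ alphaBeta N β := alphaBeta_nonneg hβ1
  have hc := logConst_nonneg N hβ1
  have hs₀ : 0 ≤ (max 0 (1 - ‖u₀‖ ^ ((N : ℝ) / 2))) ^ (2 / (N : ℝ)) :=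
    Real.rpow_nonneg (le_max_left _ _) _
  -- The strict inequality leaves room for s above the limiting norm s₀ and for the loss 1+ε; κ =
  -- p(1+ε)s^γ stays below 1.
  obtain ⟨s, hs, ε, hε, hκ⟩ := exists_gt_mul_rpow_lt_one hγ
    (mul_rpow_lt_one_of_lt_threshold hβ1 (norm_nonneg u₀) hpU)
  obtain ⟨τ, hτ1, hτ2⟩ := exists_between hs
  have hτ0 := hs₀.trans hτ1.le
  -- The interval (s₀, s) is shared: τ bounds ‖u_k − u₀‖ eventually, and d = s − τ bounds the local
  -- norm of `u₀`, so the coefficient τ + d is s.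
  obtain ⟨T, C, hT, hT1, hC, hin⟩ := exists_uniform_log_bound hβ0 hβ1 hnorm hτ0 (sub_pos.2 hτ2)
    (eventually_norm_sub_le hnorm hfn hgrad hlap hτ1)
  -- Separates the additive constant C from the logarithm under the γ-th power, at the cost of the
  -- factor 1+ε on the logarithm.
  obtain ⟨K, hK, hKle⟩ := exists_add_rpow_le hγ hε
  refine iSup_lintegral_exp_lt_top (T := T) (B := 1)
    (D := p * alphaBeta N β * (K * C ^ gammaExp N β)) (mul_nonneg (by linarith) hα)
    (half_le_gammaExp hβ hβ1) hκ (fun k => (hnorm k).le) (fun k => ?_)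
    (fun k => by simpa only [hnorm k, mul_one] using ae_abs_fn_le_of_le_norm_sq hβ0 (u k) hT)
  filter_upwards [hin k] with x hx hxT
  have hL : 0 ≤ logSq (‖x‖ ^ 2 / 2) :=
    zero_le_one.trans (one_le_logSq (by positivity) (by linarith))
  have hs0 : 0 ≤ s := hτ0.trans hτ2.le
  rw [add_sub_cancel] at hx
  have h1 : |fn (u k) x| ^ gammaExp N β ≤ (1 + ε) * (logConst N β ^ gammaExp N β *
      s ^ gammaExp N β * logSq (‖x‖ ^ 2 / 2)) + K * C ^ gammaExp N β := by
    refine (Real.rpow_le_rpow (abs_nonneg _) (hx hxT) hγ.le).trans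
      ((hKle _ C (by positivity) hC).trans_eq ?_)
    rw [Real.mul_rpow (by positivity) (by positivity), Real.mul_rpow hc hs0, ← Real.rpow_mul hL,
      one_div_mul_cancel hγ.ne', Real.rpow_one]
  calc p * alphaBeta N β * |fn (u k) x| ^ gammaExp N β
      ≤ p * alphaBeta N β * ((1 + ε) * (logConst N β ^ gammaExp N β *
          s ^ gammaExp N β * logSq (‖x‖ ^ 2 / 2)) + K * C ^ gammaExp N β) := by gcongr
    _ = p * (1 + ε) * s ^ gammaExp N β * (alphaBeta N β * logConst N β ^ gammaExp N β) *
          logSq (‖x‖ ^ 2 / 2) + p * alphaBeta N β * (K * C ^ gammaExp N β) := by ring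
    _ ≤ p * (1 + ε) * s ^ gammaExp N β * N * logSq (‖x‖ ^ 2 / 2) +
          p * alphaBeta N β * (K * C ^ gammaExp N β) := by
        gcongr
        exact alphaBeta_mul_logConst_rpow_le hβ1
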